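/- **Setting.** Let $m\ge 1$, let $H_1,\dots,H_m$ be separable real Hilbert spaces, let $H=\bigoplus_{i=1}^m H_i$ be their Hilbert direct sum, and let $F=f+g$ with $g(x)=\sum_{i=1}^m g_i(x_i)$. Assume: - $f\colon H\to\mathbb R$ is convex and differentiable; - each $g_i\colon H_i\to\,]-\infty,+\infty]$ is proper, convex and lower semicontinuous; - for all $x\in H$ and $i$, the map $v\mapsto\nabla f(x_1,\dots,x_{i-1},v,x_{i+1},\dots,x_m)$ is Lipschitz continuous on $H_i$ with constant $L_{\mathrm{res}}>0$, and its $i$-th component $v\mapsto\nabla_i f(x_1,\dots,x_{i-1},v,x_{i+1},\dots,x_m)$ is Lipschitz continuous with constant $L_i\ge 0$; - $F$ attains its minimum $F^*$ on $H$. **Algorithm.** Let $(i_k)_{k\in\mathbb N}$ be i.i.d. random variables with values in $\{1,\dots,m\}$ and $p_i:=\mathsf P(i_k=i)>0$ for every $i$. Let $\tau\in\mathbb N$, and let $d^k\in\mathbb N^m$ be deterministic delay vectors with $\max_i d^k_i\le\min\{k,\tau\}$. Let $\gamma_1,\dots,\gamma_m>0$, and let $x^0\in H$ be deterministic with $F(x^0)<+\infty$.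 For $k=0,1,\dots$ put $$x^{k+1}_{i}=\begin{cases}\operatorname{prox}_{\gamma_{i} g_{i}}\bigl(x^k_{i}-\gamma_{i}\nabla_{i}f(x_1^{k-d_1^k},\dots,x_m^{k-d_m^k})\bigr)& \text{if } i=i_k,\\ x^k_i& \text{if } i\ne i_k,\end{cases}$$ where $\operatorname{prox}_{\varphi}(y)=\operatorname{argmin}_z\ \varphi(z)+\tfrac12\|z-y\|^2$. **Notation.** Write $p_{\min}=\min_i p_i$, $p_{\max}=\max_i p_i$, $\gamma_{\max}=\max_i\gamma_i$ and $$\delta=\max_{i}\Bigl(L_i\gamma_i+2\gamma_i\tau L_{\mathrm{res}}\frac{p_{\max}}{\sqrt{p_{\min}}}\Bigr).$$ Let $\|x\|_{\Gamma^{-1}}^2=\sum_i\gamma_i^{-1}\|x_i\|^2$. Denote by $\operatorname{dist}_{\Gamma^{-1}}$ the distance, by $\operatorname{prox}^{\Gamma^{-1}}_g(y)=\operatorname{argmin}_z\, g(z)+\tfrac12\|z-y\|_{\Gamma^{-1}}^2$ the proximity operator, and by $\nabla^{\Gamma^{-1}}f=(\gamma_i\nabla_i f)_i$ the gradient in this norm.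 **Theorem.** Assume $\delta<2$. Assume that for some set $X\subset H$ that almost surely contains all $x^k$, $k\in\mathbb N$, and some $C>0$, the Luo–Tseng error bound holds on $X$: $$\operatorname{dist}_{\Gamma^{-1}}(x,\operatorname{argmin}F)\le C\,\bigl\|x-\operatorname{prox}^{\Gamma^{-1}}_{g}\bigl(x-\nabla^{\Gamma^{-1}}f(x)\bigr)\bigr\|_{\Gamma^{-1}}\qquad\text{for all }x\in X.$$ Put $$\kappa=1+\frac{(2C+\delta-2)_+}{2-\delta},\qquad \theta=\frac{\tau L_{\mathrm{res}}\gamma_{\max}}{2-\delta}\Bigl(\frac{p_{\max}^2}{\sqrt{p_{\min}}}+1\Bigr),\qquad \rho=1-\frac{p_{\min}}{\kappa+\theta}.$$ Then $$\kappa=\max\Bigl\{1,\frac{2C}{2-\delta}\Bigr\},\qquad \theta\le\frac{\sqrt{p_{\min}}}{p_{\max}(2-\delta)}\Bigl(\frac{p_{\max}^2}{\sqrt{p_{\min}}}+1\Bigr),$$ and the following hold. (i) For every $k\in\mathbb N$, $\ \mathsf E[F(x^{k+1})-F^*]\le\rho^{\lfloor (k+1)/(\tau+1)\rfloor}\,\mathsf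 E[F(x^0)-F^*]$. (ii) There is a random variable $x^*$ with values in $\operatorname{argmin}F$ such that $x^k\to x^*$ strongly almost surely, $\|x^k-x^*\|_{\Gamma^{-1}}$ is integrable for every $k$, and $\mathsf E\bigl[\|x^k-x^*\|_{\Gamma^{-1}}\bigr]=O\bigl(\rho^{\lfloor k/(\tau+1)\rfloor/2}\bigr)$ as $k\to\infty$. -/

import Mathlib

open MeasureTheory ProbabilityTheory Filter Topology Asymptotics
open scoped NNReal ENNReal

namespace AsyncFB

/-- Proper, convex, lower semicontinuous functions with values in `]-∞, +∞]`. -/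
structure ProperConvexLSC {E : Type*} [NormedAddCommGroup E] [InnerProductSpace ℝ E]
    (φ : E → EReal) : Prop where
  ne_bot : ∀ x, φ x ≠ ⊥
  proper : ∃ x, φ x ≠ ⊤
  convex : ∀ x y : E, ∀ a b : ℝ, 0 ≤ a → 0 ≤ b → a + b = 1 →
    φ (a • x + b • y) ≤ (a : EReal) * φ x + (b : EReal) * φ y
  lsc : LowerSemicontinuous φ

/-- The set of (global) minimizers of an extended-real-valued function. -/
def argminSet {E : Type*} (φ : E → EReal) : Set E := {x | ∀ y, φ x ≤ φ y}

/-- The proximity operator `prox_φ y = argmin_z φ z + ‖z - y‖² / 2` of a proper convex lower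
semicontinuous function on a Hilbert space (the minimizer exists and is unique). -/
noncomputable def prox {E : Type*} [NormedAddCommGroup E] (φ : E → EReal) (y : E) : E :=
  Classical.epsilon fun z => z ∈ argminSet fun w => φ w + ((‖w - y‖ ^ 2 / 2 : ℝ) : EReal)

section Blocks

variable {m : ℕ} {H : Fin m → Type*} [∀ i, NormedAddCommGroup (H i)]
  [∀ i, InnerProductSpace ℝ (H i)]

/-- The separable function `g x = ∑ i, g i (x i)` on the Hilbert direct sum. -/
noncomputable def sepSum (g : ∀ i, H i → EReal) (x : PiLp 2 H) : EReal := ∑ i, g i (x i)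

/-- The composite objective `F = f + g`. -/
noncomputable def objective (f : PiLp 2 H → ℝ) (g : ∀ i, H i → EReal) (x : PiLp 2 H) : EReal :=
  (f x : EReal) + sepSum g x

/-- Replace the `i`-th block of `x` by `v`. -/
noncomputable def setBlock (x : PiLp 2 H) (i : Fin m) (v : H i) : PiLp 2 H :=
  WithLp.toLp 2 (Function.update (fun j => x j) i v)

/-- The inner product `⟨x, y⟩_A = ∑ i, a i * ⟨x i, y i⟩` attached to `A = ⨁ a i • Id`. -/
noncomputable def innerW (a : Fin m → ℝ) (x y : PiLp 2 H) : ℝ := ∑ i, a i * inner ℝ (x i) (y i)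

/-- The norm `‖x‖_A = (∑ i, a i * ‖x i‖²)^(1/2)` attached to `A = ⨁ a i • Id`. -/
noncomputable def normW (a : Fin m → ℝ) (x : PiLp 2 H) : ℝ := √(∑ i, a i * ‖x i‖ ^ 2)

/-- The distance from `x` to a nonempty set `S` in the norm `‖·‖_A`. -/
noncomputable def distW (a : Fin m → ℝ) (x : PiLp 2 H) (S : Set (PiLp 2 H)) : ℝ :=
  ⨅ z : S, normW a (x - (z : PiLp 2 H))

/-- The proximity operator of `φ` in the norm `‖·‖_A`. -/
noncomputable def proxW (a : Fin m → ℝ) (φ : PiLp 2 H → EReal) (y : PiLp 2 H) : PiLp 2 H :=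
  Classical.epsilon fun z =>
    z ∈ argminSet fun w => φ w + ((normW a (w - y) ^ 2 / 2 : ℝ) : EReal)

variable [∀ i, CompleteSpace (H i)]

/-- The gradient of `f` in the inner product `⟨·, ·⟩_A`, for positive weights `a`. -/
noncomputable def gradW (a : Fin m → ℝ) (f : PiLp 2 H → ℝ) (x : PiLp 2 H) : PiLp 2 H :=
  WithLp.toLp 2 fun i => (a i)⁻¹ • (gradient f x) i

/-- `gradW` is characterized by `⟨∇^A f x, u⟩_A = ⟨∇ f x, u⟩`. -/
theorem innerW_gradW (a : Fin m → ℝ) (ha : ∀ i, 0 < a i) (f : PiLp 2 H → ℝ) (x u : PiLp 2 H) :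
    innerW a (gradW a f x) u = inner ℝ (gradient f x) u := by
  simp only [innerW, gradW, PiLp.inner_apply, real_inner_smul_left]
  refine Finset.sum_congr rfl fun i _ => ?_
  rw [← mul_assoc, mul_inv_cancel₀ (ha i).ne', one_mul]

/-- The Luo–Tseng error bound on `X`, with constant `C`, in the norm of `Γ⁻¹ = ⨁ (γ i)⁻¹ • Id`. -/
def LuoTsengErrorBound (f : PiLp 2 H → ℝ) (g : ∀ i, H i → EReal) (γ : Fin m → ℝ)
    (X : Set (PiLp 2 H)) (C : ℝ) : Prop :=
  ∀ x ∈ X, distW (fun i => (γ i)⁻¹) x (argminSet (objective f g)) ≤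
    C * normW (fun i => (γ i)⁻¹)
      (x - proxW (fun i => (γ i)⁻¹) (sepSum g) (x - gradW (fun i => (γ i)⁻¹) f x))

/-- The delayed point whose `j`-th block is the `j`-th block of `y (k - d j)`. -/
noncomputable def delayed (y : ℕ → PiLp 2 H) (k : ℕ) (d : Fin m → ℕ) : PiLp 2 H :=
  WithLp.toLp 2 fun j => y (k - d j) j

/-- The sequence `y` is generated by the asynchronous block-coordinate forward-backward algorithm
from `x0`, with stepsizes `γ`, delay vectors `d k` and selected blocks `s k`. -/
structure IsGenerated (f : PiLp 2 H → ℝ) (g : ∀ i, H i → EReal) (γ : Fin m → ℝ)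
    (d : ℕ → Fin m → ℕ) (x0 : PiLp 2 H) (s : ℕ → Fin m) (y : ℕ → PiLp 2 H) : Prop where
  init : y 0 = x0
  selected : ∀ k, y (k + 1) (s k) =
    prox (fun z => (γ (s k) : EReal) * g (s k) z)
      (y k (s k) - γ (s k) • (gradient f (delayed y k (d k))) (s k))
  other : ∀ k i, i ≠ s k → y (k + 1) i = y k i

end Blocks

section Constants

variable {m : ℕ} [NeZero m]

/-- The largest entry of a finite family. -/
noncomputable def maxOf (a : Fin m → ℝ) : ℝ := Finset.univ.sup' Finset.univ_nonempty a

/-- The smallest entry of a finite family. -/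
noncomputable def minOf (a : Fin m → ℝ) : ℝ := Finset.univ.inf' Finset.univ_nonempty a

/-- `δ = max_i (L_i γ_i + 2 γ_i τ L_res p_max / √p_min)`. -/
noncomputable def deltaC (L : Fin m → ℝ≥0) (Lres : ℝ≥0) (γ p : Fin m → ℝ) (τ : ℕ) : ℝ :=
  maxOf fun i => (L i : ℝ) * γ i + 2 * γ i * τ * Lres * (maxOf p / √(minOf p))

/-- `κ = 1 + (2 C + δ - 2)_+ / (2 - δ)`. -/
noncomputable def kappaC (C δ : ℝ) : ℝ := 1 + max (2 * C + δ - 2) 0 / (2 - δ)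

/-- `θ = τ L_res γ_max / (2 - δ) * (p_max² / √p_min + 1)`. -/
noncomputable def thetaC (Lres : ℝ≥0) (γ p : Fin m → ℝ) (τ : ℕ) (δ : ℝ) : ℝ :=
  τ * Lres * maxOf γ / (2 - δ) * (maxOf p ^ 2 / √(minOf p) + 1)

end Constants

/-- The expected optimality gap `E[F(Y) - inf F]`, as an extended nonnegative number. -/
noncomputable def expGap {Ω E : Type*} [MeasurableSpace Ω] (P : Measure Ω) (F : E → EReal)
    (Y : Ω → E) : ℝ≥0∞ :=
  ∫⁻ ω, (F (Y ω) - ⨅ z, F z).toENNReal ∂P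

end AsyncFB

/-!
The argument is a Lyapunov analysis of the expected optimality gap `G k = E[F(x k) - F*]`. Along the
window of the last `τ` steps, the error `∇f(x k) - ∇f(delayed x k)` is at most `L_res` times the sum
of the step lengths, since each step changes a single block. Let `M h` and `N h` be the expected
squared lengths of step `h`, in the norms `‖·‖` and `‖·‖_{Γ⁻¹}`, and put `c = L_res p_max / (2 √p_min)`.
The sequence `a k = G k + c ∑ (τ - (k - 1 - h)) M h`, the sum running over the window, then decreases
by at least `(1 - δ / 2) N k` in every step (`sum_objR_setBlock_le_of_delay`, `lyapunov_succ_le`).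

The heart of the proof is the converse estimate `mul_gap_le_of_delay`, which bounds `p_min G k` by
`κ (a k - a (k + 1))` plus a multiple of the past squared step lengths. The error bound controls the
distance to `argmin F` by the residual with the exact gradient, whereas the algorithm moves along the
delayed one. By firm nonexpansiveness of the proximity operator, the two forward-backward points in
block `i` differ by a vector in the ball with diameter `[0, γ i • err i]`, where `err` is the gradient
error (`IsForwardBackward.half_sum_sq_le`). Hence the first-order error terms produced by the error
bound are dominated by those already present in the decrease of `F`, so that the factor `κ` is that of
the algorithm without delays. What is left is of second order in the gradient error.

Summing over `τ + 1` consecutive steps gives `a (j + τ + 1) ≤ ρ a j` (`lyapunov_le_pow_mul`), provided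
that the second-order term fits into the slack `κ - p_min` (`absorption`). It does so when
`p_min ≤ 1 / 2`. If there is a single block, then `p_min = 1`; in that case the first step, which has
no delay, either reaches a minimizer or shows that `C` is so large that the slack suffices
(`expected_first_step`).

The iterates at time `k` are functions of the finitely many selections before time `k`, so all random
variables take finitely many values, and the selection at time `k` is averaged out by independence
(`integral_selected`). The decrease of `a` makes `E ‖x (k + 1) - x k‖` decay geometrically. Hence the
iterates are almost surely Cauchy, with the stated rate for the expected distance to the limit
(`exists_limit_of_integral_norm_sub_le`), and the limit minimizes `F` by lower semicontinuity.
-/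

namespace AsyncFB

/-! ### Proximity operators of proper convex lower semicontinuous functions -/

section Prox

variable {E : Type*} [NormedAddCommGroup E] [InnerProductSpace ℝ E] {φ : E → EReal}

theorem ProperConvexLSC.coe_toReal (hφ : ProperConvexLSC φ) {x : E} (hx : φ x ≠ ⊤) :
    ((φ x).toReal : EReal) = φ x :=
  EReal.coe_toReal hx (hφ.ne_bot x)

theorem ProperConvexLSC.convex_real (hφ : ProperConvexLSC φ) {x y : E} (hx : φ x ≠ ⊤)
    (hy : φ y ≠ ⊤) {a b : ℝ} (ha : 0 ≤ a) (hb : 0 ≤ b) (hab : a + b = 1) :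
    φ (a • x + b • y) ≠ ⊤ ∧
      (φ (a • x + b • y)).toReal ≤ a * (φ x).toReal + b * (φ y).toReal := by
  have h := hφ.convex x y a b ha hb hab
  rw [← hφ.coe_toReal hx, ← hφ.coe_toReal hy, ← EReal.coe_mul, ← EReal.coe_mul,
    ← EReal.coe_add] at h
  have h1 : φ (a • x + b • y) ≠ ⊤ := ne_top_of_le_ne_top (EReal.coe_ne_top _) h
  refine ⟨h1, ?_⟩
  rw [← hφ.coe_toReal h1] at h
  exact EReal.coe_le_coe_iff.1 h

/-- A proper convex lower semicontinuous function decreases at most linearly. Lower semicontinuity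
bounds it below on a ball around a point of its domain, and convexity propagates the bound. -/
theorem ProperConvexLSC.exists_linear_minorant (hφ : ProperConvexLSC φ) :
    ∃ (x₀ : E) (c c' : ℝ), 0 ≤ c' ∧ ∀ z, φ z ≠ ⊤ → c - c' * ‖z - x₀‖ ≤ (φ z).toReal := by
  obtain ⟨x₀, hx₀⟩ := hφ.proper
  have hlt : (((φ x₀).toReal - 1 : ℝ) : EReal) < φ x₀ := by
    conv_rhs => rw [← hφ.coe_toReal hx₀]
    exact EReal.coe_lt_coe_iff.2 (by linarith)
  obtain ⟨r, hr, hball⟩ := Metric.eventually_nhds_iff.1 (hφ.lsc x₀ _ hlt)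
  refine ⟨x₀, (φ x₀).toReal - 1, 2 / r, by positivity, fun z hz => ?_⟩
  by_cases hzr : dist z x₀ < r
  · have h : (((φ x₀).toReal - 1 : ℝ) : EReal) < φ z := hball hzr
    rw [← hφ.coe_toReal hz, EReal.coe_lt_coe_iff] at h
    have : 0 ≤ 2 / r * ‖z - x₀‖ := by positivity
    linarith
  · push Not at hzr
    rw [dist_eq_norm] at hzr
    have hpos : 0 < ‖z - x₀‖ := hr.trans_le hzr
    set t : ℝ := r / (2 * ‖z - x₀‖) with ht
    have ht0 : 0 < t := by positivity
    have ht1 : t ≤ 1 := by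
      rw [ht, div_le_one (by positivity)]
      linarith
    obtain ⟨h1, h2⟩ := hφ.convex_real hx₀ hz (sub_nonneg.2 ht1) ht0.le (by ring)
    have hd : dist ((1 - t) • x₀ + t • z) x₀ < r := by
      have he : (1 - t) • x₀ + t • z - x₀ = t • (z - x₀) := by
        rw [sub_smul, smul_sub, one_smul]
        abel
      rw [dist_eq_norm, he, norm_smul, Real.norm_of_nonneg ht0.le, ht]
      field_simp
      linarith
    have h3 : (((φ x₀).toReal - 1 : ℝ) : EReal) < φ ((1 - t) • x₀ + t • z) := hball hd
    rw [← hφ.coe_toReal h1, EReal.coe_lt_coe_iff] at h3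
    have h4 : t * ((φ x₀).toReal - (φ z).toReal) ≤ 1 := by linarith
    have h5 : (φ x₀).toReal - (φ z).toReal ≤ 1 / t := by
      rw [le_div_iff₀ ht0]
      linarith
    have h6 : 1 / t = 2 / r * ‖z - x₀‖ := by
      rw [ht]
      field_simp
    linarith

theorem norm_midpoint_sub_sq (w v y : E) :
    ‖(1 / 2 : ℝ) • w + (1 / 2 : ℝ) • v - y‖ ^ 2 =
      (1 / 2) * ‖w - y‖ ^ 2 + (1 / 2) * ‖v - y‖ ^ 2 - (1 / 4) * ‖w - v‖ ^ 2 := by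
  have h1 : (1 / 2 : ℝ) • w + (1 / 2 : ℝ) • v - y = (1 / 2 : ℝ) • ((w - y) + (v - y)) := by
    rw [smul_add, smul_sub, smul_sub]
    have : y = (1 / 2 : ℝ) • y + (1 / 2 : ℝ) • y := by rw [← add_smul]; norm_num
    nth_rw 1 [this]
    abel
  have h2 : w - v = (w - y) - (v - y) := by abel
  rw [h1, h2, norm_smul, mul_pow, norm_add_sq_real, norm_sub_sq_real (w - y) (v - y)]
  norm_num
  ring

/-- A proper convex lower semicontinuous function plus a multiple of the squared distance to a point
attains its minimum: minimizing sequences are Cauchy by strong convexity. -/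
theorem ProperConvexLSC.exists_minimizer [CompleteSpace E] (hφ : ProperConvexLSC φ) {a : ℝ}
    (ha : 0 < a) (y : E) :
    ∃ z, φ z ≠ ⊤ ∧ ∀ w, φ w ≠ ⊤ →
      (φ z).toReal + a / 2 * ‖z - y‖ ^ 2 ≤ (φ w).toReal + a / 2 * ‖w - y‖ ^ 2 := by
  set Φ : E → ℝ := fun w => (φ w).toReal + a / 2 * ‖w - y‖ ^ 2 with hΦ
  set S : Set E := {w | φ w ≠ ⊤} with hS
  have hne : (Φ '' S).Nonempty := hφ.proper.elim fun x hx => ⟨_, x, hx, rfl⟩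
  have hbdd : BddBelow (Φ '' S) := by
    obtain ⟨x₀, c, c', hc', hlin⟩ := hφ.exists_linear_minorant
    refine ⟨c - c' * ‖y - x₀‖ - c' ^ 2 / (2 * a), ?_⟩
    rintro _ ⟨z, hz, rfl⟩
    have h1 := hlin z hz
    have h2 : ‖z - x₀‖ ≤ ‖z - y‖ + ‖y - x₀‖ := norm_sub_le_norm_sub_add_norm_sub z y x₀
    have h3 : c' * ‖z - x₀‖ ≤ c' * (‖z - y‖ + ‖y - x₀‖) := mul_le_mul_of_nonneg_left h2 hc'
    have h4 : 0 ≤ a / 2 * (‖z - y‖ - c' / a) ^ 2 := by positivity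
    have h5 : a / 2 * (‖z - y‖ - c' / a) ^ 2 =
        a / 2 * ‖z - y‖ ^ 2 - c' * ‖z - y‖ + c' ^ 2 / (2 * a) := by
      field_simp
      ring
    simp only [hΦ]
    linarith
  set I : ℝ := sInf (Φ '' S) with hI
  have hIle : ∀ w, φ w ≠ ⊤ → I ≤ Φ w := fun w hw => csInf_le hbdd ⟨w, hw, rfl⟩
  have hseq : ∀ n : ℕ, ∃ w, φ w ≠ ⊤ ∧ Φ w < I + 1 / ((n : ℝ) + 1) := by
    intro n
    obtain ⟨_, ⟨w, hw, rfl⟩, h⟩ := exists_lt_of_csInf_lt hne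
      (show I < I + 1 / ((n : ℝ) + 1) from lt_add_of_pos_right _ (by positivity))
    exact ⟨w, hw, h⟩
  choose w hwS hwI using hseq
  have hdist : ∀ n k, a / 8 * ‖w n - w k‖ ^ 2 ≤ (1 / ((n : ℝ) + 1) + 1 / ((k : ℝ) + 1)) / 2 := by
    intro n k
    obtain ⟨h1, h2⟩ := hφ.convex_real (hwS n) (hwS k) (a := 1 / 2) (b := 1 / 2) (by norm_num)
      (by norm_num) (by norm_num)
    have h3 := hIle _ h1
    have h4 := hwI n
    have h5 := hwI k
    simp only [hΦ] at h3 h4 h5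
    rw [norm_midpoint_sub_sq] at h3
    linarith
  have hcauchy : CauchySeq w := by
    refine Metric.cauchySeq_iff.2 fun ε hε => ?_
    obtain ⟨n₀, hn₀⟩ := exists_nat_one_div_lt (show 0 < a / 8 * ε ^ 2 by positivity)
    refine ⟨n₀, fun (n : ℕ) hn (k : ℕ) hk => ?_⟩
    have h1 : 1 / ((n : ℝ) + 1) ≤ 1 / ((n₀ : ℝ) + 1) := by gcongr
    have h2 : 1 / ((k : ℝ) + 1) ≤ 1 / ((n₀ : ℝ) + 1) := by gcongr
    have h3 := hdist n k
    rw [dist_eq_norm]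
    refine lt_of_pow_lt_pow_left₀ 2 hε.le ?_
    have h4 : a / 8 * ‖w n - w k‖ ^ 2 < a / 8 * ε ^ 2 := by linarith
    exact lt_of_mul_lt_mul_left h4 (by positivity)
  obtain ⟨z, hz⟩ := cauchySeq_tendsto_of_complete hcauchy
  have hkey : φ z ≤ ((I - a / 2 * ‖z - y‖ ^ 2 : ℝ) : EReal) := by
    by_contra hlt
    push Not at hlt
    obtain ⟨c, hc1, hc2⟩ := EReal.lt_iff_exists_real_btwn.1 hlt
    rw [EReal.coe_lt_coe_iff] at hc1
    have hev : ∀ᶠ n : ℕ in atTop, c ≤ I + 1 / ((n : ℝ) + 1) - a / 2 * ‖w n - y‖ ^ 2 := by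
      filter_upwards [hz.eventually (hφ.lsc z _ hc2)] with n hn
      rw [← hφ.coe_toReal (hwS n), gt_iff_lt, EReal.coe_lt_coe_iff] at hn
      have := hwI n
      simp only [hΦ] at this
      linarith
    have hlim : Tendsto (fun n : ℕ => I + 1 / ((n : ℝ) + 1) - a / 2 * ‖w n - y‖ ^ 2) atTop
        (𝓝 (I + 0 - a / 2 * ‖z - y‖ ^ 2)) :=
      (tendsto_const_nhds.add tendsto_one_div_add_atTop_nhds_zero_nat).sub
        (((hz.sub_const y).norm.pow 2).const_mul _)
    have := ge_of_tendsto hlim hev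
    linarith
  have hzS : φ z ≠ ⊤ := ne_top_of_le_ne_top (EReal.coe_ne_top _) hkey
  refine ⟨z, hzS, fun v hv => ?_⟩
  rw [← hφ.coe_toReal hzS, EReal.coe_le_coe_iff] at hkey
  have := hIle v hv
  simp only [hΦ] at this
  linarith

/-- The variational inequality that characterizes minimizers of `φ + a / 2 * ‖· - y‖²`. -/
theorem ProperConvexLSC.variational_ineq (hφ : ProperConvexLSC φ) {a : ℝ} {y z : E}
    (hz : φ z ≠ ⊤) (hmin : ∀ w, φ w ≠ ⊤ →
      (φ z).toReal + a / 2 * ‖z - y‖ ^ 2 ≤ (φ w).toReal + a / 2 * ‖w - y‖ ^ 2)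
    {w : E} (hw : φ w ≠ ⊤) :
    (φ z).toReal + a * inner ℝ (y - z) (w - z) ≤ (φ w).toReal := by
  have hstep : ∀ t : ℝ, 0 < t → t ≤ 1 →
      (φ z).toReal + a * inner ℝ (y - z) (w - z) - (φ w).toReal ≤ t * (a / 2 * ‖w - z‖ ^ 2) := by
    intro t ht ht1
    obtain ⟨h1, h2⟩ := hφ.convex_real hz hw (sub_nonneg.2 ht1) ht.le (by ring)
    have h3 := hmin _ h1
    have h4 : (1 - t) • z + t • w - y = t • (w - z) - (y - z) := by
      rw [sub_smul, smul_sub, one_smul]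
      abel
    have h5 : ‖z - y‖ = ‖y - z‖ := norm_sub_rev _ _
    rw [h4, norm_sub_sq_real (t • (w - z)), norm_smul, Real.norm_of_nonneg ht.le,
      real_inner_smul_left, h5, real_inner_comm] at h3
    have h6 : t * ((φ z).toReal + a * inner ℝ (y - z) (w - z) - (φ w).toReal) ≤
        t * (t * (a / 2 * ‖w - z‖ ^ 2)) := by
      nlinarith
    exact le_of_mul_le_mul_left h6 ht
  have hlim : Tendsto (fun t : ℝ => t * (a / 2 * ‖w - z‖ ^ 2)) (𝓝[>] 0) (𝓝 0) := by
    have : Tendsto (fun t : ℝ => t * (a / 2 * ‖w - z‖ ^ 2)) (𝓝 0)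
        (𝓝 (0 * (a / 2 * ‖w - z‖ ^ 2))) := tendsto_id.mul_const _
    rw [zero_mul] at this
    exact this.mono_left nhdsWithin_le_nhds
  have hev : ∀ᶠ t : ℝ in 𝓝[>] 0,
      (φ z).toReal + a * inner ℝ (y - z) (w - z) - (φ w).toReal ≤ t * (a / 2 * ‖w - z‖ ^ 2) := by
    filter_upwards [Ioc_mem_nhdsGT (zero_lt_one (α := ℝ))] with t ht
    exact hstep t ht.1 ht.2
  have := ge_of_tendsto hlim hev
  linarith

/-- The proximity operator of `γ φ`, by its variational inequality. -/
theorem ProperConvexLSC.prox_spec [CompleteSpace E] (hφ : ProperConvexLSC φ) {γ : ℝ} (hγ : 0 < γ)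
    (y : E) :
    φ (prox (fun z => (γ : EReal) * φ z) y) ≠ ⊤ ∧ ∀ w, φ w ≠ ⊤ →
      (φ (prox (fun z => (γ : EReal) * φ z) y)).toReal +
        γ⁻¹ * inner ℝ (y - prox (fun z => (γ : EReal) * φ z) y)
          (w - prox (fun z => (γ : EReal) * φ z) y) ≤ (φ w).toReal := by
  have hval : ∀ w, φ w ≠ ⊤ → (γ : EReal) * φ w + ((‖w - y‖ ^ 2 / 2 : ℝ) : EReal) =
      ((γ * ((φ w).toReal + γ⁻¹ / 2 * ‖w - y‖ ^ 2) : ℝ) : EReal) := by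
    intro w hw
    rw [← hφ.coe_toReal hw, ← EReal.coe_mul, ← EReal.coe_add, EReal.toReal_coe]
    congr 1
    field_simp
  have hex : ∃ z, z ∈ argminSet fun w => (γ : EReal) * φ w + ((‖w - y‖ ^ 2 / 2 : ℝ) : EReal) := by
    obtain ⟨z, hz, hmin⟩ := hφ.exists_minimizer (inv_pos.2 hγ) y
    refine ⟨z, fun w => ?_⟩
    by_cases hw : φ w = ⊤
    · simp only [hw, EReal.coe_mul_top_of_pos hγ, EReal.top_add_coe, le_top]
    · simp only [hval z hz, hval w hw, EReal.coe_le_coe_iff]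
      exact mul_le_mul_of_nonneg_left (hmin w hw) hγ.le
  have hspec : prox (fun z => (γ : EReal) * φ z) y ∈
      argminSet fun w => (γ : EReal) * φ w + ((‖w - y‖ ^ 2 / 2 : ℝ) : EReal) :=
    Classical.epsilon_spec hex
  set z := prox (fun z => (γ : EReal) * φ z) y with hzdef
  have hz : φ z ≠ ⊤ := by
    intro htop
    obtain ⟨w, hw⟩ := hφ.proper
    have h := hspec w
    simp only [hval w hw, htop, EReal.coe_mul_top_of_pos hγ, EReal.top_add_coe, top_le_iff] at h
    exact EReal.coe_ne_top _ h
  refine ⟨hz, fun w hw => hφ.variational_ineq hz (fun v hv => ?_) hw⟩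
  have h := hspec v
  simp only [hval z hz, hval v hv, EReal.coe_le_coe_iff] at h
  exact le_of_mul_le_mul_left h hγ

end Prox

/-! ### Convex functions with block-Lipschitz gradients -/

section Smooth

variable {E : Type*} [NormedAddCommGroup E] [InnerProductSpace ℝ E] [CompleteSpace E] {f : E → ℝ}

theorem hasDerivAt_comp_line (hf : Differentiable ℝ f) (a v : E) (t : ℝ) :
    HasDerivAt (fun t : ℝ => f (a + t • v)) (inner ℝ (gradient f (a + t • v)) v) t := by
  have h1 : HasDerivAt (fun t : ℝ => a + t • v) v t := by
    simpa using ((hasDerivAt_id t).smul_const v).const_add a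
  have h2 := (hf (a + t • v)).hasFDerivAt.comp_hasDerivAt t h1
  rwa [inner_gradient_left]

/-- The descent inequality along a segment. -/
theorem le_add_inner_gradient (hf : Differentiable ℝ f) {a v : E} {K : ℝ}
    (hK : ∀ t ∈ Set.Icc (0 : ℝ) 1,
      inner ℝ (gradient f (a + t • v) - gradient f a) v ≤ K * t) :
    f (a + v) ≤ f a + inner ℝ (gradient f a) v + K / 2 := by
  set c : ℝ := inner ℝ (gradient f a) v with hc
  have hder : ∀ t : ℝ, HasDerivAt (fun t : ℝ => f (a + t • v) - c * t - K / 2 * t ^ 2)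
      (inner ℝ (gradient f (a + t • v)) v - c - K * t) t := by
    intro t
    have h1 := ((hasDerivAt_comp_line hf a v t).sub ((hasDerivAt_id t).const_mul c)).sub
      (((hasDerivAt_id t).pow 2).const_mul (K / 2))
    refine h1.congr_deriv ?_
    norm_num
    ring
  have hanti : AntitoneOn (fun t : ℝ => f (a + t • v) - c * t - K / 2 * t ^ 2) (Set.Icc 0 1) := by
    refine antitoneOn_of_deriv_nonpos (convex_Icc 0 1)
      (fun t _ => (hder t).continuousAt.continuousWithinAt)
      (fun t _ => (hder t).differentiableAt.differentiableWithinAt) fun t ht => ?_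
    rw [(hder t).deriv]
    have h2 := hK t (interior_subset ht)
    rw [inner_sub_left] at h2
    linarith
  have h3 := hanti (Set.left_mem_Icc.2 zero_le_one) (Set.right_mem_Icc.2 zero_le_one) zero_le_one
  simp only [one_smul, zero_smul, add_zero, mul_one, mul_zero] at h3
  norm_num at h3
  linarith

theorem add_inner_gradient_le (hconv : ConvexOn ℝ Set.univ f) (hf : Differentiable ℝ f) (a b : E) :
    f a + inner ℝ (gradient f a) (b - a) ≤ f b := by
  have hline : ConvexOn ℝ Set.univ (fun t : ℝ => f (a + t • (b - a))) := by
    refine ⟨convex_univ, fun s _ t _ α β hα hβ hαβ => ?_⟩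
    have h := hconv.2 (Set.mem_univ (a + s • (b - a))) (Set.mem_univ (a + t • (b - a))) hα hβ hαβ
    convert h using 2
    rw [smul_add, smul_add, add_add_add_comm, ← add_smul, hαβ, one_smul, smul_smul, smul_smul,
      ← add_smul, smul_eq_mul, smul_eq_mul]
  have h := hline.le_slope_of_hasDerivAt (Set.mem_univ 0) (Set.mem_univ 1) zero_lt_one
    (hasDerivAt_comp_line hf a (b - a) 0)
  simp only [slope_def_field, zero_smul, one_smul, add_zero, add_sub_cancel, sub_zero,
    div_one] at h
  linarith

end Smooth

section Blocks

variable {m : ℕ} {H : Fin m → Type*}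

@[simp]
theorem setBlock_apply_self (x : PiLp 2 H) (i : Fin m) (v : H i) : setBlock x i v i = v := by
  simp [setBlock]

theorem setBlock_apply_of_ne (x : PiLp 2 H) {i j : Fin m} (hj : j ≠ i) (v : H i) :
    setBlock x i v j = x j := by
  simp [setBlock, hj]

theorem eq_setBlock {x y : PiLp 2 H} {i : Fin m} (h : ∀ j, j ≠ i → y j = x j) :
    y = setBlock x i (y i) := by
  ext j
  by_cases hj : j = i
  · subst hj
    simp
  · rw [setBlock_apply_of_ne x hj, h j hj]

theorem sum_setBlock_sub {M : Type*} [AddCommGroup M] (φ : ∀ i, H i → M) (x : PiLp 2 H)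
    (i : Fin m) (v : H i) :
    ∑ j, φ j (setBlock x i v j) = ∑ j, φ j (x j) + (φ i v - φ i (x i)) := by
  rw [← Finset.add_sum_erase _ _ (Finset.mem_univ i),
    ← Finset.add_sum_erase _ (fun j => φ j (x j)) (Finset.mem_univ i), setBlock_apply_self,
    Finset.sum_congr rfl fun j hj => by rw [setBlock_apply_of_ne x (Finset.ne_of_mem_erase hj)]]
  abel

variable [∀ i, NormedAddCommGroup (H i)]

theorem norm_le_sum_norm_apply (x : PiLp 2 H) : ‖x‖ ≤ ∑ i, ‖x i‖ := by
  refine le_of_sq_le_sq ?_ (Finset.sum_nonneg fun i _ => norm_nonneg _)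
  rw [PiLp.norm_sq_eq_of_L2]
  exact Finset.sum_sq_le_sq_sum_of_nonneg fun i _ => norm_nonneg _

/-- Lipschitz continuity in each block gives Lipschitz continuity for the sum of the norms of the
blocks: change the blocks one at a time. -/
theorem norm_sub_le_of_lipschitz_blocks {F : Type*} [NormedAddCommGroup F] {T : PiLp 2 H → F}
    {K : ℝ≥0} (hT : ∀ x i, LipschitzWith K fun v : H i => T (setBlock x i v)) (a b : PiLp 2 H) :
    ‖T a - T b‖ ≤ K * ∑ i, ‖a i - b i‖ := by
  classical
  set mix : Finset (Fin m) → PiLp 2 H := fun t => WithLp.toLp 2 fun j => if j ∈ t then a j else b j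
    with hmix
  have key : ∀ t : Finset (Fin m), ‖T (mix t) - T b‖ ≤ K * ∑ i ∈ t, ‖a i - b i‖ := by
    intro t
    induction t using Finset.induction_on with
    | empty =>
      have : mix ∅ = b := by
        ext j
        simp [hmix]
      simp [this]
    | insert i t hi ih =>
      have h1 : mix (insert i t) = setBlock (mix t) i (a i) := by
        ext j
        by_cases hj : j = i
        · subst hj
          simp [hmix]
        · rw [setBlock_apply_of_ne _ hj]
          simp [hmix, hj]
      have h2 : mix t = setBlock (mix t) i (b i) := by
        ext j
        by_cases hj : j = i
        · subst hj
          simp [hmix, hi]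
        · rw [setBlock_apply_of_ne _ hj]
      have h3 := (hT (mix t) i).dist_le_mul (a i) (b i)
      rw [← h1, ← h2, dist_eq_norm, dist_eq_norm] at h3
      rw [Finset.sum_insert hi, mul_add]
      calc ‖T (mix (insert i t)) - T b‖
          ≤ ‖T (mix (insert i t)) - T (mix t)‖ + ‖T (mix t) - T b‖ :=
            norm_sub_le_norm_sub_add_norm_sub _ _ _
        _ ≤ _ := add_le_add h3 ih
  have h := key Finset.univ
  have huniv : mix Finset.univ = a := by
    ext j
    simp [hmix]
  rwa [huniv] at h

variable [∀ i, InnerProductSpace ℝ (H i)]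

theorem inner_setBlock_sub (u x : PiLp 2 H) (i : Fin m) (v : H i) :
    inner ℝ u (setBlock x i v - x) = inner ℝ (u i) (v - x i) := by
  rw [PiLp.inner_apply, Finset.sum_eq_single i]
  · simp
  · intro j _ hj
    simp [setBlock_apply_of_ne x hj]
  · simp

variable [∀ i, CompleteSpace (H i)] {f : PiLp 2 H → ℝ}

theorem setBlock_le_add_inner_gradient (hf : Differentiable ℝ f) {K : ℝ≥0} (x : PiLp 2 H)
    (i : Fin m) (hK : LipschitzWith K fun v : H i => (gradient f (setBlock x i v)) i) (v : H i) :
    f (setBlock x i v) ≤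
      f x + inner ℝ (gradient f x i) (v - x i) + (K : ℝ) / 2 * ‖v - x i‖ ^ 2 := by
  have h := le_add_inner_gradient hf (a := x) (v := setBlock x i v - x) (K := K * ‖v - x i‖ ^ 2)
    (fun t ht => by
      have h1 : x + t • (setBlock x i v - x) = setBlock x i (x i + t • (v - x i)) := by
        ext j
        by_cases hj : j = i
        · subst hj
          simp
        · simp [setBlock_apply_of_ne x hj]
      have h2 : x = setBlock x i (x i) := eq_setBlock fun _ _ => rfl
      have h3 := hK.dist_le_mul (x i + t • (v - x i)) (x i)
      rw [← h2, ← h1, dist_eq_norm, dist_eq_norm, add_sub_cancel_left, norm_smul,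
        Real.norm_of_nonneg ht.1] at h3
      rw [inner_setBlock_sub]
      calc inner ℝ ((gradient f (x + t • (setBlock x i v - x)) - gradient f x) i) (v - x i)
          ≤ ‖(gradient f (x + t • (setBlock x i v - x)) - gradient f x) i‖ * ‖v - x i‖ :=
            real_inner_le_norm _ _
        _ ≤ (K * (t * ‖v - x i‖)) * ‖v - x i‖ := by
            refine mul_le_mul_of_nonneg_right ?_ (norm_nonneg _)
            simpa using h3
        _ = K * ‖v - x i‖ ^ 2 * t := by ring)
  rw [add_sub_cancel, inner_setBlock_sub] at h
  linarith

theorem le_add_inner_gradient_of_lipschitz_blocks (hf : Differentiable ℝ f) {K : ℝ≥0}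
    (hK : ∀ x i, LipschitzWith K fun v : H i => gradient f (setBlock x i v)) (x z : PiLp 2 H)
    {S : ℝ} (hS : ∑ i, ‖x i - z i‖ ≤ S) :
    f x ≤ f z + inner ℝ (gradient f z) (x - z) + (K : ℝ) / 2 * S ^ 2 := by
  have hS0 : 0 ≤ S := (Finset.sum_nonneg fun i _ => norm_nonneg _).trans hS
  have h := le_add_inner_gradient hf (a := z) (v := x - z) (K := K * S ^ 2) (fun t ht => by
    have h1 := norm_sub_le_of_lipschitz_blocks hK (z + t • (x - z)) z
    have h2 : ∑ i, ‖(z + t • (x - z)) i - z i‖ ≤ t * S := by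
      refine le_trans (le_of_eq ?_) (mul_le_mul_of_nonneg_left hS ht.1)
      rw [Finset.mul_sum]
      refine Finset.sum_congr rfl fun i _ => ?_
      simp [norm_smul, abs_of_nonneg ht.1]
    have h3 : ‖x - z‖ ≤ S := (norm_le_sum_norm_apply _).trans (by simpa using hS)
    calc inner ℝ (gradient f (z + t • (x - z)) - gradient f z) (x - z)
        ≤ ‖gradient f (z + t • (x - z)) - gradient f z‖ * ‖x - z‖ := real_inner_le_norm _ _
      _ ≤ (K * (t * S)) * S := by
        have h4 := h1.trans (mul_le_mul_of_nonneg_left h2 K.coe_nonneg)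
        have := (norm_nonneg _).trans h4
        gcongr
      _ = K * S ^ 2 * t := by ring)
  rw [add_sub_cancel] at h
  linarith

end Blocks

/-! ### Forward-backward points -/

section ForwardBackward

variable {E : Type*} [NormedAddCommGroup E] [InnerProductSpace ℝ E]

/-- `z` is the forward-backward point `prox_{γ φ} (x - γ e)`, expressed by its variational
inequality. -/
structure IsForwardBackward (γ : ℝ) (φ : E → EReal) (x e z : E) : Prop where
  ne_top : φ z ≠ ⊤
  le : ∀ w, φ w ≠ ⊤ →
    (φ z).toReal + γ⁻¹ * inner ℝ (x - z) (w - z) ≤ (φ w).toReal + inner ℝ e (w - z)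

theorem isForwardBackward_of_le {γ : ℝ} (hγ : 0 < γ) {φ : E → EReal} {x e z : E} (hz : φ z ≠ ⊤)
    (h : ∀ w, φ w ≠ ⊤ →
      (φ z).toReal + γ⁻¹ * inner ℝ (x - γ • e - z) (w - z) ≤ (φ w).toReal) :
    IsForwardBackward γ φ x e z := by
  refine ⟨hz, fun w hw => ?_⟩
  have h1 := h w hw
  have h2 : x - γ • e - z = (x - z) - γ • e := by abel
  rw [h2, inner_sub_left, real_inner_smul_left, mul_sub, ← mul_assoc, inv_mul_cancel₀ hγ.ne',
    one_mul] at h1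
  linarith

theorem isForwardBackward_prox [CompleteSpace E] {γ : ℝ} (hγ : 0 < γ) {φ : E → EReal}
    (hφ : ProperConvexLSC φ) (x e : E) :
    IsForwardBackward γ φ x e (prox (fun z => (γ : EReal) * φ z) (x - γ • e)) :=
  isForwardBackward_of_le hγ (hφ.prox_spec hγ _).1 (hφ.prox_spec hγ _).2

/-- Firm nonexpansiveness of the proximity operator, for two forward steps from the same point. -/
theorem IsForwardBackward.norm_sub_sq_le {γ : ℝ} (hγ : 0 < γ) {φ : E → EReal} {x e e' z t : E}
    (hz : IsForwardBackward γ φ x e z) (ht : IsForwardBackward γ φ x e' t) :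
    ‖z - t‖ ^ 2 ≤ inner ℝ (γ • (e' - e)) (z - t) := by
  have h1 := hz.le t ht.ne_top
  have h2 := ht.le z hz.ne_top
  have h3 : γ⁻¹ * (inner ℝ (x - z) (t - z) + inner ℝ (x - t) (z - t)) ≤
      inner ℝ (e' - e) (z - t) := by
    rw [inner_sub_left e' e, mul_add]
    have : inner ℝ e (t - z) = -inner ℝ e (z - t) := by rw [← inner_neg_right, neg_sub]
    linarith
  have h4 : inner ℝ (x - z) (t - z) + inner ℝ (x - t) (z - t) = ‖z - t‖ ^ 2 := by
    rw [← neg_sub z t, inner_neg_right, ← real_inner_self_eq_norm_sq, ← sub_eq_neg_add,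
      ← inner_sub_left]
    congr 1
    abel
  rw [h4, inv_mul_le_iff₀ hγ] at h3
  rwa [real_inner_smul_left]

/-- The residual of the step with the direction `e'` is controlled by the step made with `e`. Since
the two points differ by a vector in the ball with diameter `[0, γ (e' - e)]`, the linear error term
is half the sum of `⟨e' - e, x - z⟩` and its upper bound. -/
theorem IsForwardBackward.half_sum_sq_le {γ : ℝ} (hγ : 0 < γ) {φ : E → EReal} {x e e' z t : E}
    (hz : IsForwardBackward γ φ x e z) (ht : IsForwardBackward γ φ x e' t) :
    γ⁻¹ * ((‖x - z‖ ^ 2 + ‖x - t‖ ^ 2) / 2) ≤ γ⁻¹ * ‖x - z‖ ^ 2 +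
      inner ℝ (e' - e) (x - z) / 2 + ‖e' - e‖ * ‖x - z‖ / 2 + γ * ‖e' - e‖ ^ 2 / 2 := by
  have h1 := hz.norm_sub_sq_le hγ ht
  set y := γ • (e' - e) with hy
  set w := z - t with hw
  set D := x - z with hD
  have hxt : x - t = D + w := by rw [hD, hw]; abel
  have hyn : ‖y‖ = γ * ‖e' - e‖ := by rw [hy, norm_smul, Real.norm_of_nonneg hγ.le]
  have hwy : ‖w‖ ≤ ‖y‖ := by
    have h2 := h1.trans (real_inner_le_norm y w)
    rcases (norm_nonneg w).eq_or_lt with h0 | h0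
    · rw [← h0]
      exact norm_nonneg _
    · rw [sq] at h2
      exact le_of_mul_le_mul_right h2 h0
  have hball : ‖w - (1 / 2 : ℝ) • y‖ ≤ ‖y‖ / 2 := by
    refine le_of_sq_le_sq ?_ (by positivity)
    rw [norm_sub_sq_real, real_inner_smul_right, norm_smul, real_inner_comm]
    norm_num
    nlinarith
  have hlin : inner ℝ D w ≤ inner ℝ y D / 2 + ‖y‖ * ‖D‖ / 2 := by
    have h3 := real_inner_le_norm D (w - (1 / 2 : ℝ) • y)
    rw [inner_sub_right, real_inner_smul_right, real_inner_comm y D] at h3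
    have h4 := mul_le_mul_of_nonneg_left hball (norm_nonneg D)
    linarith
  have hsq : ‖w‖ ^ 2 ≤ ‖y‖ ^ 2 := pow_le_pow_left₀ (norm_nonneg _) hwy 2
  have hkey : (‖D‖ ^ 2 + ‖x - t‖ ^ 2) / 2 ≤
      ‖D‖ ^ 2 + inner ℝ y D / 2 + ‖y‖ * ‖D‖ / 2 + ‖y‖ ^ 2 / 2 := by
    rw [hxt, norm_add_sq_real]
    linarith
  have h5 := mul_le_mul_of_nonneg_left hkey (inv_nonneg.2 hγ.le)
  refine h5.trans (le_of_eq ?_)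
  rw [hyn, hy, real_inner_smul_left]
  field_simp

end ForwardBackward

section Blocks

variable {m : ℕ} {H : Fin m → Type*} [∀ i, NormedAddCommGroup (H i)]

theorem normW_nonneg (a : Fin m → ℝ) (x : PiLp 2 H) : 0 ≤ normW a x := Real.sqrt_nonneg _

theorem normW_sq {a : Fin m → ℝ} (ha : ∀ i, 0 ≤ a i) (x : PiLp 2 H) :
    normW a x ^ 2 = ∑ i, a i * ‖x i‖ ^ 2 :=
  Real.sq_sqrt (Finset.sum_nonneg fun i _ => mul_nonneg (ha i) (sq_nonneg _))

variable [∀ i, InnerProductSpace ℝ (H i)]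

theorem innerW_le_normW_mul_normW {a : Fin m → ℝ} (ha : ∀ i, 0 ≤ a i) (x y : PiLp 2 H) :
    innerW a x y ≤ normW a x * normW a y := by
  refine le_trans (Finset.sum_le_sum fun i _ => ?_)
    (Real.sum_sqrt_mul_sqrt_le _ (fun i => mul_nonneg (ha i) (sq_nonneg ‖x i‖))
      fun i => mul_nonneg (ha i) (sq_nonneg ‖y i‖))
  rw [Real.sqrt_mul (ha i), Real.sqrt_mul (ha i), Real.sqrt_sq (norm_nonneg _),
    Real.sqrt_sq (norm_nonneg _), mul_mul_mul_comm, Real.mul_self_sqrt (ha i)]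
  exact mul_le_mul_of_nonneg_left (real_inner_le_norm _ _) (ha i)

/-- The real value of the objective; it agrees with `objective` where all `g i (x i)` are finite. -/
noncomputable def objR (f : PiLp 2 H → ℝ) (g : ∀ i, H i → EReal) (x : PiLp 2 H) : ℝ :=
  f x + ∑ i, (g i (x i)).toReal

theorem coe_finset_sum_ereal {ι : Type*} (t : Finset ι) (r : ι → ℝ) :
    ((∑ i ∈ t, r i : ℝ) : EReal) = ∑ i ∈ t, (r i : EReal) :=
  map_sum (⟨⟨Real.toEReal, EReal.coe_zero⟩, EReal.coe_add⟩ : ℝ →+ EReal) r t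

variable {f : PiLp 2 H → ℝ} {g : ∀ i, H i → EReal}

theorem sepSum_eq_coe (hg : ∀ i, ProperConvexLSC (g i)) {x : PiLp 2 H} (hx : ∀ i, g i (x i) ≠ ⊤) :
    sepSum g x = ((∑ i, (g i (x i)).toReal : ℝ) : EReal) := by
  rw [coe_finset_sum_ereal, sepSum]
  exact Finset.sum_congr rfl fun i _ => ((hg i).coe_toReal (hx i)).symm

theorem sum_ne_bot (hg : ∀ i, ProperConvexLSC (g i)) (x : PiLp 2 H) (t : Finset (Fin m)) :
    ∑ i ∈ t, g i (x i) ≠ ⊥ := by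
  induction t using Finset.induction_on with
  | empty => simp
  | insert i t hi ih =>
    rw [Finset.sum_insert hi, Ne, EReal.add_eq_bot_iff]
    exact not_or_intro ((hg i).ne_bot _) ih

theorem sepSum_eq_top (hg : ∀ i, ProperConvexLSC (g i)) {x : PiLp 2 H} {i : Fin m}
    (hi : g i (x i) = ⊤) : sepSum g x = ⊤ := by
  rw [sepSum, ← Finset.add_sum_erase _ _ (Finset.mem_univ i), hi]
  exact EReal.top_add_of_ne_bot (sum_ne_bot hg x _)

theorem objective_eq_coe (hg : ∀ i, ProperConvexLSC (g i)) {x : PiLp 2 H}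
    (hx : ∀ i, g i (x i) ≠ ⊤) : objective f g x = (objR f g x : EReal) := by
  rw [objective, sepSum_eq_coe hg hx, objR, EReal.coe_add]

theorem objective_ne_top_iff (hg : ∀ i, ProperConvexLSC (g i)) {x : PiLp 2 H} :
    objective f g x ≠ ⊤ ↔ ∀ i, g i (x i) ≠ ⊤ := by
  refine ⟨fun h i hi => h ?_, fun h => ?_⟩
  · rw [objective, sepSum_eq_top hg hi, EReal.coe_add_top]
  · rw [objective_eq_coe hg h]
    exact EReal.coe_ne_top _

theorem exists_objective_ne_top (hg : ∀ i, ProperConvexLSC (g i)) :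
    ∃ x : PiLp 2 H, ∀ i, g i (x i) ≠ ⊤ := by
  choose w hw using fun i => (hg i).proper
  exact ⟨WithLp.toLp 2 w, hw⟩

theorem ne_top_of_mem_argminSet (hg : ∀ i, ProperConvexLSC (g i)) {y : PiLp 2 H}
    (hy : y ∈ argminSet (objective f g)) (i : Fin m) : g i (y i) ≠ ⊤ := by
  obtain ⟨w, hw⟩ := exists_objective_ne_top hg
  refine (objective_ne_top_iff (f := f) hg).1 (ne_top_of_le_ne_top ?_ (hy w)) i
  exact (objective_ne_top_iff hg).2 hw

theorem objR_le_of_mem_argminSet (hg : ∀ i, ProperConvexLSC (g i)) {xm : PiLp 2 H}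
    (hxm : xm ∈ argminSet (objective f g)) {y : PiLp 2 H} (hy : ∀ i, g i (y i) ≠ ⊤) :
    objR f g xm ≤ objR f g y := by
  have h1 := hxm y
  rwa [objective_eq_coe hg hy, objective_eq_coe hg (ne_top_of_mem_argminSet hg hxm),
    EReal.coe_le_coe_iff] at h1

variable [∀ i, CompleteSpace (H i)]

/-- The proximity operator of a separable function in a weighted norm acts blockwise. -/
theorem isForwardBackward_proxW (hg : ∀ i, ProperConvexLSC (g i)) {γ : Fin m → ℝ}
    (hγ : ∀ i, 0 < γ i) (x : PiLp 2 H) (i : Fin m) :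
    IsForwardBackward (γ i) (g i) (x i) (gradient f x i)
      (proxW (fun i => (γ i)⁻¹) (sepSum g) (x - gradW (fun i => (γ i)⁻¹) f x) i) := by
  set a : Fin m → ℝ := fun i => (γ i)⁻¹ with ha
  have ha0 : ∀ i, 0 < a i := fun i => inv_pos.2 (hγ i)
  set y := x - gradW a f x with hy
  have hyi : ∀ i, y i = x i - γ i • gradient f x i := fun i => by simp [hy, gradW, ha]
  have hval : ∀ w : PiLp 2 H, (∀ i, g i (w i) ≠ ⊤) →
      sepSum g w + ((normW a (w - y) ^ 2 / 2 : ℝ) : EReal) =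
        ((∑ i, ((g i (w i)).toReal + a i / 2 * ‖w i - y i‖ ^ 2) : ℝ) : EReal) := by
    intro w hw
    rw [sepSum_eq_coe hg hw, ← EReal.coe_add, normW_sq (fun i => (ha0 i).le),
      Finset.sum_add_distrib, Finset.sum_div]
    congr 2
    refine Finset.sum_congr rfl fun i _ => ?_
    simp only [PiLp.sub_apply]
    ring
  have hex : ∃ z, z ∈ argminSet fun w => sepSum g w + ((normW a (w - y) ^ 2 / 2 : ℝ) : EReal) := by
    choose z hz hmin using fun i => (hg i).exists_minimizer (ha0 i) (y i)
    refine ⟨WithLp.toLp 2 z, fun w => ?_⟩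
    by_cases hw : ∀ i, g i (w i) ≠ ⊤
    · simp only [hval _ hz, hval w hw, EReal.coe_le_coe_iff]
      exact Finset.sum_le_sum fun i _ => hmin i _ (hw i)
    · push Not at hw
      obtain ⟨j, hj⟩ := hw
      simp only [sepSum_eq_top hg hj, EReal.top_add_coe, le_top]
  have hspec : proxW a (sepSum g) y ∈
      argminSet fun w => sepSum g w + ((normW a (w - y) ^ 2 / 2 : ℝ) : EReal) :=
    Classical.epsilon_spec hex
  set t := proxW a (sepSum g) y
  have ht : ∀ i, g i (t i) ≠ ⊤ := by
    intro j hj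
    obtain ⟨w, hw⟩ := exists_objective_ne_top hg
    have h := hspec w
    simp only [hval w hw, sepSum_eq_top hg hj, EReal.top_add_coe, top_le_iff] at h
    exact EReal.coe_ne_top _ h
  refine isForwardBackward_of_le (hγ i) (ht i) ?_
  rw [← hyi i]
  refine fun w hw => (hg i).variational_ineq (ht i) (fun v hv => ?_) hw
  have hv' : ∀ j, g j (setBlock t i v j) ≠ ⊤ := by
    intro j
    by_cases hj : j = i
    · subst hj
      rwa [setBlock_apply_self]
    · rw [setBlock_apply_of_ne t hj]
      exact ht j
  have h := hspec (setBlock t i v)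
  simp only [hval t ht, hval _ hv', EReal.coe_le_coe_iff] at h
  rw [sum_setBlock_sub (fun j v => (g j v).toReal + a j / 2 * ‖v - y j‖ ^ 2) t i v] at h
  simp only [ha] at h ⊢
  linarith

end Blocks

/-! ### One step of the algorithm -/

section OneStep

variable {m : ℕ} {H : Fin m → Type*} [∀ i, NormedAddCommGroup (H i)]
  [∀ i, InnerProductSpace ℝ (H i)]
  {f : PiLp 2 H → ℝ} {g : ∀ i, H i → EReal}

/-- The part of the guaranteed decrease in block `i`, for the step from `x` to `xb` along `e`, that
exceeds the squared step length. It is nonnegative at forward-backward points. -/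
noncomputable def surplus (g : ∀ i, H i → EReal) (γ : Fin m → ℝ) (x e xb : PiLp 2 H) (i : Fin m) :
    ℝ :=
  (g i (x i)).toReal - (g i (xb i)).toReal + inner ℝ (e i) (x i - xb i) -
    (γ i)⁻¹ * ‖x i - xb i‖ ^ 2

theorem surplus_nonneg {γ : Fin m → ℝ} {x e xb : PiLp 2 H} {i : Fin m} (hx : g i (x i) ≠ ⊤)
    (hfb : IsForwardBackward (γ i) (g i) (x i) (e i) (xb i)) : 0 ≤ surplus g γ x e xb i := by
  have h := hfb.le (x i) hx
  rw [real_inner_self_eq_norm_sq] at h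
  unfold surplus
  linarith

variable [∀ i, CompleteSpace (H i)]

theorem objR_setBlock_le (hf : Differentiable ℝ f) {γ : Fin m → ℝ} (hγ : ∀ i, 0 < γ i)
    {K : ℝ≥0} (x e xb : PiLp 2 H) (i : Fin m)
    (hK : LipschitzWith K fun v : H i => (gradient f (setBlock x i v)) i) :
    objR f g (setBlock x i (xb i)) ≤ objR f g x - surplus g γ x e xb i -
      (1 - K * γ i / 2) * ((γ i)⁻¹ * ‖x i - xb i‖ ^ 2) -
      inner ℝ (gradient f x i - e i) (x i - xb i) := by
  have h := setBlock_le_add_inner_gradient hf x i hK (xb i)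
  have h1 : inner ℝ (gradient f x i) (xb i - x i) = -inner ℝ (gradient f x i) (x i - xb i) := by
    rw [← inner_neg_right, neg_sub]
  have h2 : (K : ℝ) * γ i / 2 * ((γ i)⁻¹ * ‖x i - xb i‖ ^ 2) = K / 2 * ‖x i - xb i‖ ^ 2 := by
    have := (hγ i).ne'
    field_simp
  rw [norm_sub_rev (xb i), h1] at h
  unfold objR surplus
  rw [sum_setBlock_sub (fun j v => (g j v).toReal) x i (xb i), sub_mul, h2, inner_sub_left]
  linarith

/-- The optimality gap at `x` with respect to a competitor `y`, for a gradient taken at `z`. The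
delay enters only through the second-order error `S²`. -/
theorem objR_sub_le (hconv : ConvexOn ℝ Set.univ f) (hf : Differentiable ℝ f) {γ : Fin m → ℝ}
    {K : ℝ≥0} (hK : ∀ x i, LipschitzWith K fun v : H i => gradient f (setBlock x i v))
    {x z xb y : PiLp 2 H} (hy : ∀ i, g i (y i) ≠ ⊤)
    (hfb : ∀ i, IsForwardBackward (γ i) (g i) (x i) (gradient f z i) (xb i))
    {S : ℝ} (hS : ∑ i, ‖x i - z i‖ ≤ S) :
    objR f g x - objR f g y ≤ ∑ i, surplus g γ x (gradient f z) xb i +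
      innerW (fun i => (γ i)⁻¹) (x - xb) (x - y) + (K : ℝ) / 2 * S ^ 2 := by
  have h1 := le_add_inner_gradient_of_lipschitz_blocks hf hK x z hS
  have h2 := add_inner_gradient_le hconv hf z y
  have h3 : inner ℝ (gradient f z) (x - z) - inner ℝ (gradient f z) (y - z) =
      ∑ i, inner ℝ (gradient f z i) (x i - y i) := by
    rw [← inner_sub_right, PiLp.inner_apply]
    refine Finset.sum_congr rfl fun i _ => ?_
    congr 1
    simp
  have h4 : ∑ i, ((g i (x i)).toReal - (g i (y i)).toReal) ≤
      ∑ i, (surplus g γ x (gradient f z) xb i + (γ i)⁻¹ * inner ℝ ((x - xb) i) ((x - y) i) -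
        inner ℝ (gradient f z i) (x i - y i)) := by
    refine Finset.sum_le_sum fun i _ => ?_
    have h5 := (hfb i).le (y i) (hy i)
    have h6 : y i - xb i = (x i - xb i) - (x i - y i) := by abel
    rw [h6, inner_sub_right (x i - xb i) (x i - xb i),
      inner_sub_right (gradient f z i) (x i - xb i), real_inner_self_eq_norm_sq] at h5
    simp only [surplus, PiLp.sub_apply]
    linarith
  rw [Finset.sum_sub_distrib, Finset.sum_sub_distrib, Finset.sum_add_distrib] at h4
  unfold objR innerW
  linarith

/-- The Luo–Tseng error bound turns the competitor into the undelayed residual. -/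
theorem objR_sub_le_of_errorBound (hconv : ConvexOn ℝ Set.univ f) (hf : Differentiable ℝ f)
    (hg : ∀ i, ProperConvexLSC (g i)) {γ : Fin m → ℝ} (hγ : ∀ i, 0 < γ i)
    {K : ℝ≥0} (hK : ∀ x i, LipschitzWith K fun v : H i => gradient f (setBlock x i v))
    {X : Set (PiLp 2 H)} {C : ℝ} (heb : LuoTsengErrorBound f g γ X C)
    {xm : PiLp 2 H} (hxm : xm ∈ argminSet (objective f g))
    {x z xb : PiLp 2 H} (hxX : x ∈ X)
    (hfb : ∀ i, IsForwardBackward (γ i) (g i) (x i) (gradient f z i) (xb i))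
    {S : ℝ} (hS : ∑ i, ‖x i - z i‖ ≤ S) :
    objR f g x - objR f g xm ≤ ∑ i, surplus g γ x (gradient f z) xb i +
      normW (fun i => (γ i)⁻¹) (x - xb) * (C * normW (fun i => (γ i)⁻¹)
        (x - proxW (fun i => (γ i)⁻¹) (sepSum g) (x - gradW (fun i => (γ i)⁻¹) f x))) +
      (K : ℝ) / 2 * S ^ 2 := by
  set a : Fin m → ℝ := fun i => (γ i)⁻¹ with ha
  have ha0 : ∀ i, 0 ≤ a i := fun i => (inv_pos.2 (hγ i)).le
  set r := normW a (x - proxW a (sepSum g) (x - gradW a f x))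
  have hd : distW a x (argminSet (objective f g)) ≤ C * r := heb x hxX
  have hstep : ∀ ε : ℝ, 0 < ε → objR f g x - objR f g xm ≤
      ∑ i, surplus g γ x (gradient f z) xb i + normW a (x - xb) * (C * r + ε) +
        (K : ℝ) / 2 * S ^ 2 := by
    intro ε hε
    have : Nonempty (argminSet (objective f g)) := ⟨⟨xm, hxm⟩⟩
    obtain ⟨⟨y, hy⟩, hylt⟩ := exists_lt_of_ciInf_lt
      (show ⨅ z : argminSet (objective f g), normW a (x - (z : PiLp 2 H)) < C * r + ε from
        lt_of_le_of_lt hd (by linarith))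
    have hyd := ne_top_of_mem_argminSet hg hy
    have hval : objR f g y = objR f g xm := by
      have h1 := hy xm
      have h2 := hxm y
      rw [objective_eq_coe hg hyd, objective_eq_coe hg (ne_top_of_mem_argminSet hg hxm),
        EReal.coe_le_coe_iff] at h1 h2
      exact le_antisymm h1 h2
    rw [← hval]
    refine (objR_sub_le hconv hf hK hyd hfb hS).trans ?_
    have h3 := innerW_le_normW_mul_normW ha0 (x - xb) (x - y)
    have h4 := mul_le_mul_of_nonneg_left hylt.le (normW_nonneg a (x - xb))
    simp only at h4
    linarith
  have hlim : Tendsto (fun ε : ℝ => ∑ i, surplus g γ x (gradient f z) xb i +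
      normW a (x - xb) * (C * r + ε) + (K : ℝ) / 2 * S ^ 2) (𝓝[>] 0)
      (𝓝 (∑ i, surplus g γ x (gradient f z) xb i +
        normW a (x - xb) * (C * r + 0) + (K : ℝ) / 2 * S ^ 2)) := by
    refine Tendsto.mono_left (Continuous.tendsto ?_ 0) nhdsWithin_le_nhds
    fun_prop
  have h := ge_of_tendsto hlim (eventually_nhdsWithin_of_forall fun ε hε => hstep ε hε)
  rwa [add_zero] at h

/-- The gap estimate weighted by the probabilities; the residual of the delayed step and the
undelayed residual enter through the mean of their squares. -/
theorem mul_objR_sub_le (hconv : ConvexOn ℝ Set.univ f) (hf : Differentiable ℝ f)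
    (hg : ∀ i, ProperConvexLSC (g i)) {γ : Fin m → ℝ} (hγ : ∀ i, 0 < γ i)
    {K : ℝ≥0} (hK : ∀ x i, LipschitzWith K fun v : H i => gradient f (setBlock x i v))
    {X : Set (PiLp 2 H)} {C : ℝ} (hC : 0 < C) (heb : LuoTsengErrorBound f g γ X C)
    {xm : PiLp 2 H} (hxm : xm ∈ argminSet (objective f g))
    {p : Fin m → ℝ} {pm : ℝ} (hpm : 0 ≤ pm) (hp : ∀ i, pm ≤ p i)
    {x z xb : PiLp 2 H} (hxX : x ∈ X) (hx : ∀ i, g i (x i) ≠ ⊤)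
    (hfb : ∀ i, IsForwardBackward (γ i) (g i) (x i) (gradient f z i) (xb i))
    {S : ℝ} (hS : ∑ i, ‖x i - z i‖ ≤ S) :
    pm * (objR f g x - objR f g xm) ≤ ∑ i, p i * surplus g γ x (gradient f z) xb i +
      C * ∑ i, p i * ((γ i)⁻¹ * ‖x i - xb i‖ ^ 2 +
        inner ℝ (gradient f x i - gradient f z i) (x i - xb i) / 2 +
        ‖gradient f x i - gradient f z i‖ * ‖x i - xb i‖ / 2 +
        γ i * ‖gradient f x i - gradient f z i‖ ^ 2 / 2) + pm * ((K : ℝ) / 2 * S ^ 2) := by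
  have h := objR_sub_le_of_errorBound hconv hf hg hγ hK heb hxm hxX hfb hS
  set a : Fin m → ℝ := fun i => (γ i)⁻¹ with ha
  have ha0 : ∀ i, 0 ≤ a i := fun i => (inv_pos.2 (hγ i)).le
  have ht := isForwardBackward_proxW (f := f) hg hγ x
  set t := proxW a (sepSum g) (x - gradW a f x)
  have h1 : pm * ∑ i, surplus g γ x (gradient f z) xb i ≤
      ∑ i, p i * surplus g γ x (gradient f z) xb i := by
    rw [Finset.mul_sum]
    exact Finset.sum_le_sum fun i _ =>
      mul_le_mul_of_nonneg_right (hp i) (surplus_nonneg (hx i) (hfb i))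
  have h2 : normW a (x - xb) * normW a (x - t) ≤
      ∑ i, (γ i)⁻¹ * ((‖x i - xb i‖ ^ 2 + ‖x i - t i‖ ^ 2) / 2) := by
    have h3 := two_mul_le_add_sq (normW a (x - xb)) (normW a (x - t))
    rw [normW_sq ha0, normW_sq ha0, ← Finset.sum_add_distrib] at h3
    have h4 : ∑ i, (γ i)⁻¹ * ((‖x i - xb i‖ ^ 2 + ‖x i - t i‖ ^ 2) / 2) =
        (∑ i, (a i * ‖(x - xb) i‖ ^ 2 + a i * ‖(x - t) i‖ ^ 2)) / 2 := by
      rw [Finset.sum_div]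
      refine Finset.sum_congr rfl fun i _ => ?_
      simp only [PiLp.sub_apply, ha]
      ring
    rw [h4]
    linarith
  have h5 : pm * ∑ i, (γ i)⁻¹ * ((‖x i - xb i‖ ^ 2 + ‖x i - t i‖ ^ 2) / 2) ≤
      ∑ i, p i * ((γ i)⁻¹ * ‖x i - xb i‖ ^ 2 +
        inner ℝ (gradient f x i - gradient f z i) (x i - xb i) / 2 +
        ‖gradient f x i - gradient f z i‖ * ‖x i - xb i‖ / 2 +
        γ i * ‖gradient f x i - gradient f z i‖ ^ 2 / 2) := by
    rw [Finset.mul_sum]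
    refine Finset.sum_le_sum fun i _ => ?_
    have h6 : 0 ≤ (γ i)⁻¹ * ((‖x i - xb i‖ ^ 2 + ‖x i - t i‖ ^ 2) / 2) :=
      mul_nonneg (ha0 i) (by positivity)
    exact mul_le_mul (hp i) ((hfb i).half_sum_sq_le (hγ i) (ht i)) h6 (hpm.trans (hp i))
  have h7 := mul_le_mul_of_nonneg_left h hpm
  have h8 := mul_le_mul_of_nonneg_left (mul_le_mul_of_nonneg_left h2 hpm) hC.le
  have h9 := mul_le_mul_of_nonneg_left h5 hC.le
  linarith

/-- The expected decrease of the objective, before the error terms due to the delay are estimated.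
The constants `η` and `u` encode the stepsize condition. -/
theorem sum_objR_setBlock_le (hf : Differentiable ℝ f) {γ : Fin m → ℝ} (hγ : ∀ i, 0 < γ i)
    {L : Fin m → ℝ≥0}
    (hL : ∀ x i, LipschitzWith (L i) fun v : H i => (gradient f (setBlock x i v)) i)
    {p : Fin m → ℝ} (hp0 : ∀ i, 0 ≤ p i) (hp1 : ∑ i, p i = 1)
    {η c : ℝ} (hη : ∀ i, L i * γ i + 4 * γ i * c ≤ 2 - 2 * η) (x e xb : PiLp 2 H) :
    ∑ i, p i * objR f g (setBlock x i (xb i)) ≤ objR f g x - ∑ i, p i * surplus g γ x e xb i -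
      η * ∑ i, p i * ((γ i)⁻¹ * ‖x i - xb i‖ ^ 2) - 2 * c * ∑ i, p i * ‖x i - xb i‖ ^ 2 -
      ∑ i, p i * inner ℝ (gradient f x i - e i) (x i - xb i) := by
  have h1 : objR f g x = ∑ i, p i * objR f g x := by rw [← Finset.sum_mul, hp1, one_mul]
  rw [h1, Finset.mul_sum, Finset.mul_sum, ← Finset.sum_sub_distrib, ← Finset.sum_sub_distrib,
    ← Finset.sum_sub_distrib, ← Finset.sum_sub_distrib]
  refine Finset.sum_le_sum fun i _ => ?_
  have h2 := objR_setBlock_le (g := g) hf hγ x e xb i (hL x i)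
  have h3 : (η + 2 * γ i * c) * ((γ i)⁻¹ * ‖x i - xb i‖ ^ 2) ≤
      (1 - L i * γ i / 2) * ((γ i)⁻¹ * ‖x i - xb i‖ ^ 2) := by
    refine mul_le_mul_of_nonneg_right ?_ (mul_nonneg (inv_nonneg.2 (hγ i).le) (sq_nonneg _))
    have := hη i
    linarith
  have h4 : (η + 2 * γ i * c) * ((γ i)⁻¹ * ‖x i - xb i‖ ^ 2) =
      η * ((γ i)⁻¹ * ‖x i - xb i‖ ^ 2) + 2 * c * ‖x i - xb i‖ ^ 2 := by
    have := (hγ i).ne'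
    field_simp
  have h5 := mul_le_mul_of_nonneg_left (h2.trans (by linarith : _ ≤ objR f g x -
    surplus g γ x e xb i - (η * ((γ i)⁻¹ * ‖x i - xb i‖ ^ 2) + 2 * c * ‖x i - xb i‖ ^ 2) -
      inner ℝ (gradient f x i - e i) (x i - xb i))) (hp0 i)
  linarith

omit [∀ i, InnerProductSpace ℝ (H i)] [∀ i, CompleteSpace (H i)] in
theorem sum_mul_norm_sq_le {u : ℝ} {p : Fin m → ℝ} (hpu : ∀ i, p i ≤ u ^ 2) (v : PiLp 2 H) :
    ∑ i, p i * ‖v i‖ ^ 2 ≤ u ^ 2 * ‖v‖ ^ 2 := by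
  rw [PiLp.norm_sq_eq_of_L2, Finset.mul_sum]
  exact Finset.sum_le_sum fun i _ => mul_le_mul_of_nonneg_right (hpu i) (sq_nonneg _)

omit [∀ i, InnerProductSpace ℝ (H i)] [∀ i, CompleteSpace (H i)] in
theorem sum_mul_norm_mul_norm_le {K u S Q : ℝ} {τ : ℕ} {p : Fin m → ℝ} (hp0 : ∀ i, 0 ≤ p i)
    (hK : 0 ≤ K) (hu : 0 ≤ u) (hpu : ∀ i, p i ≤ u ^ 2) {err D : PiLp 2 H} (herr : ‖err‖ ≤ K * S)
    (hSQ : ∀ v : ℝ, 2 * S * v ≤ Q + τ * v ^ 2) :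
    ∑ i, p i * (‖err i‖ * ‖D i‖) ≤ K * u / 2 * (τ * ∑ i, p i * ‖D i‖ ^ 2 + Q) := by
  have h1 : ∑ i, p i * (‖err i‖ * ‖D i‖) ≤
      √(∑ i, p i * ‖err i‖ ^ 2) * √(∑ i, p i * ‖D i‖ ^ 2) := by
    refine le_trans (le_of_eq (Finset.sum_congr rfl fun i _ => ?_))
      (Real.sum_sqrt_mul_sqrt_le _ (fun i => mul_nonneg (hp0 i) (sq_nonneg ‖err i‖))
        fun i => mul_nonneg (hp0 i) (sq_nonneg ‖D i‖))
    rw [Real.sqrt_mul (hp0 i), Real.sqrt_mul (hp0 i), Real.sqrt_sq (norm_nonneg _),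
      Real.sqrt_sq (norm_nonneg _), mul_mul_mul_comm, Real.mul_self_sqrt (hp0 i)]
  have h2 : √(∑ i, p i * ‖err i‖ ^ 2) ≤ u * (K * S) := by
    refine Real.sqrt_le_iff.2 ⟨mul_nonneg hu ((norm_nonneg _).trans herr), ?_⟩
    rw [mul_pow]
    exact (sum_mul_norm_sq_le hpu err).trans (mul_le_mul_of_nonneg_left
      (pow_le_pow_left₀ (norm_nonneg _) herr 2) (sq_nonneg _))
  have h3 := mul_le_mul_of_nonneg_right h2 (Real.sqrt_nonneg (∑ i, p i * ‖D i‖ ^ 2))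
  have h4 := mul_le_mul_of_nonneg_left (hSQ √(∑ i, p i * ‖D i‖ ^ 2))
    (div_nonneg (mul_nonneg hK hu) two_pos.le)
  rw [Real.sq_sqrt (Finset.sum_nonneg fun i _ => mul_nonneg (hp0 i) (sq_nonneg _))] at h4
  linarith

omit [∀ i, InnerProductSpace ℝ (H i)] [∀ i, CompleteSpace (H i)] in
theorem sum_mul_mul_norm_sq_le {u G : ℝ} {γ p : Fin m → ℝ} (hp0 : ∀ i, 0 ≤ p i)
    (hpu : ∀ i, p i ≤ u ^ 2) (hG0 : 0 ≤ G) (hG : ∀ i, γ i ≤ G) (v : PiLp 2 H) :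
    ∑ i, p i * (γ i * ‖v i‖ ^ 2) ≤ G * (u ^ 2 * ‖v‖ ^ 2) := by
  refine le_trans ?_ (mul_le_mul_of_nonneg_left (sum_mul_norm_sq_le hpu v) hG0)
  rw [Finset.mul_sum]
  refine Finset.sum_le_sum fun i _ => ?_
  have := mul_le_mul_of_nonneg_right (hG i) (mul_nonneg (hp0 i) (sq_nonneg ‖v i‖))
  linarith

/-- Sufficient decrease of the expected objective in one step, up to the past step lengths `Q`. -/
theorem sum_objR_setBlock_le_of_delay (hf : Differentiable ℝ f) {γ : Fin m → ℝ}
    (hγ : ∀ i, 0 < γ i) {L : Fin m → ℝ≥0} {K : ℝ≥0}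
    (hL : ∀ x i, LipschitzWith (L i) fun v : H i => (gradient f (setBlock x i v)) i)
    (hK : ∀ x i, LipschitzWith K fun v : H i => gradient f (setBlock x i v))
    {p : Fin m → ℝ} (hp0 : ∀ i, 0 ≤ p i) (hp1 : ∑ i, p i = 1)
    {η u : ℝ} {τ : ℕ} (hu : 0 ≤ u) (hpu : ∀ i, p i ≤ u ^ 2)
    (hη : ∀ i, L i * γ i + 2 * γ i * τ * K * u ≤ 2 - 2 * η) {x z xb : PiLp 2 H}
    (hx : ∀ i, g i (x i) ≠ ⊤)
    (hfb : ∀ i, IsForwardBackward (γ i) (g i) (x i) (gradient f z i) (xb i))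
    {S Q : ℝ} (hS : ∑ i, ‖x i - z i‖ ≤ S) (hSQ : ∀ v : ℝ, 2 * S * v ≤ Q + τ * v ^ 2) :
    ∑ i, p i * objR f g (setBlock x i (xb i)) ≤ objR f g x -
      η * ∑ i, p i * ((γ i)⁻¹ * ‖x i - xb i‖ ^ 2) -
      K * u / 2 * (τ * ∑ i, p i * ‖x i - xb i‖ ^ 2 - Q) := by
  have h1 := sum_objR_setBlock_le (g := g) hf hγ hL hp0 hp1 (η := η) (c := τ * K * u / 2)
    (fun i => by linarith [hη i]) x (gradient f z) xb
  have herr : ‖gradient f x - gradient f z‖ ≤ K * S :=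
    (norm_sub_le_of_lipschitz_blocks hK x z).trans (mul_le_mul_of_nonneg_left hS K.coe_nonneg)
  have h2 := sum_mul_norm_mul_norm_le (D := x - xb) hp0 K.coe_nonneg hu hpu herr hSQ
  have h3 : -∑ i, p i * (‖(gradient f x - gradient f z) i‖ * ‖(x - xb) i‖) ≤
      ∑ i, p i * inner ℝ (gradient f x i - gradient f z i) (x i - xb i) := by
    rw [← Finset.sum_neg_distrib]
    refine Finset.sum_le_sum fun i _ => ?_
    have h4 := neg_le_of_abs_le (abs_real_inner_le_norm (gradient f x i - gradient f z i)
      (x i - xb i))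
    have h5 := mul_le_mul_of_nonneg_left h4 (hp0 i)
    simp only [PiLp.sub_apply]
    linarith
  have h6 : 0 ≤ ∑ i, p i * surplus g γ x (gradient f z) xb i :=
    Finset.sum_nonneg fun i _ => mul_nonneg (hp0 i) (surplus_nonneg (hx i) (hfb i))
  simp only [PiLp.sub_apply] at h2 h3
  linarith

/-- The optimality gap is bounded by the expected decrease in one step and the past step
lengths `Q`. The coefficient `κ` of the decrease is the one of the algorithm without delays: the
terms of first order in the gradient error cancel against those in the decrease. -/
theorem mul_gap_le_of_delay (hconv : ConvexOn ℝ Set.univ f) (hf : Differentiable ℝ f)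
    (hg : ∀ i, ProperConvexLSC (g i)) {γ : Fin m → ℝ} (hγ : ∀ i, 0 < γ i)
    {L : Fin m → ℝ≥0} {K : ℝ≥0}
    (hL : ∀ x i, LipschitzWith (L i) fun v : H i => (gradient f (setBlock x i v)) i)
    (hK : ∀ x i, LipschitzWith K fun v : H i => gradient f (setBlock x i v))
    {X : Set (PiLp 2 H)} {C : ℝ} (hC : 0 < C) (heb : LuoTsengErrorBound f g γ X C)
    {xm : PiLp 2 H} (hxm : xm ∈ argminSet (objective f g))
    {p : Fin m → ℝ} (hp1 : ∑ i, p i = 1) {pm : ℝ} (hpm : 0 ≤ pm) (hp : ∀ i, pm ≤ p i)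
    {η u G κ : ℝ} {τ : ℕ} (hu : 0 ≤ u) (hpu : ∀ i, p i ≤ u ^ 2)
    (hη : ∀ i, L i * γ i + 2 * γ i * τ * K * u ≤ 2 - 2 * η) (hη0 : 0 ≤ η) (hη1 : η ≤ 1)
    (hG0 : 0 ≤ G) (hG : ∀ i, γ i ≤ G) (hκ1 : 1 ≤ κ) (hκC : C ≤ κ * η) {x z xb : PiLp 2 H}
    (hxX : x ∈ X) (hx : ∀ i, g i (x i) ≠ ⊤)
    (hfb : ∀ i, IsForwardBackward (γ i) (g i) (x i) (gradient f z i) (xb i))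
    {S Q : ℝ} (hS : ∑ i, ‖x i - z i‖ ≤ S) (hSQ : ∀ v : ℝ, 2 * S * v ≤ Q + τ * v ^ 2)
    (hSQ' : S ^ 2 ≤ τ * Q) :
    pm * (objR f g x - objR f g xm) ≤
      κ * (objR f g x - ∑ i, p i * objR f g (setBlock x i (xb i)) +
        K * u / 2 * (Q - τ * ∑ i, p i * ‖x i - xb i‖ ^ 2)) +
      (κ * η / 2 * (G * u ^ 2 * K ^ 2 * τ) + pm * (K * τ / 2)) * Q := by
  have hp0 : ∀ i, 0 ≤ p i := fun i => hpm.trans (hp i)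
  have hS0 : 0 ≤ S := (Finset.sum_nonneg fun i _ => norm_nonneg _).trans hS
  have h1 := sum_objR_setBlock_le (g := g) hf hγ hL hp0 hp1 (η := η) (c := τ * K * u / 2)
    (fun i => by linarith [hη i]) x (gradient f z) xb
  have h2 := mul_objR_sub_le hconv hf hg hγ hK hC heb hxm hpm hp hxX hx hfb hS
  have herr : ‖gradient f x - gradient f z‖ ≤ K * S :=
    (norm_sub_le_of_lipschitz_blocks hK x z).trans (mul_le_mul_of_nonneg_left hS K.coe_nonneg)
  have h3 := sum_mul_norm_mul_norm_le (D := x - xb) hp0 K.coe_nonneg hu hpu herr hSQ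
  have h4 := sum_mul_mul_norm_sq_le hp0 hpu hG0 hG (gradient f x - gradient f z)
  simp only [PiLp.sub_apply] at h3 h4
  have hZ : ‖gradient f x - gradient f z‖ ^ 2 ≤ K ^ 2 * (τ * Q) := by
    refine (pow_le_pow_left₀ (norm_nonneg _) herr 2).trans ?_
    rw [mul_pow]
    exact mul_le_mul_of_nonneg_left hSQ' (sq_nonneg _)
  have h4' := h4.trans (mul_le_mul_of_nonneg_left (mul_le_mul_of_nonneg_left hZ (sq_nonneg u)) hG0)
  set β := ∑ i, p i * surplus g γ x (gradient f z) xb i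
  have hβ : 0 ≤ β :=
    Finset.sum_nonneg fun i _ => mul_nonneg (hp0 i) (surplus_nonneg (hx i) (hfb i))
  set N := ∑ i, p i * ((γ i)⁻¹ * ‖x i - xb i‖ ^ 2)
  set M := ∑ i, p i * ‖x i - xb i‖ ^ 2
  set A := ∑ i, p i * inner ℝ (gradient f x i - gradient f z i) (x i - xb i) with hA
  set Y := ∑ i, p i * (‖gradient f x i - gradient f z i‖ * ‖x i - xb i‖) with hY
  set Z := ∑ i, p i * (γ i * ‖gradient f x i - gradient f z i‖ ^ 2) with hZdef
  have hAY : -Y ≤ A := by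
    rw [hY, hA, ← Finset.sum_neg_distrib]
    refine Finset.sum_le_sum fun i _ => ?_
    have h5 := neg_le_of_abs_le (abs_real_inner_le_norm (gradient f x i - gradient f z i)
      (x i - xb i))
    have h6 := mul_le_mul_of_nonneg_left h5 (hp0 i)
    linarith
  have hsum : ∑ i, p i * ((γ i)⁻¹ * ‖x i - xb i‖ ^ 2 +
        inner ℝ (gradient f x i - gradient f z i) (x i - xb i) / 2 +
        ‖gradient f x i - gradient f z i‖ * ‖x i - xb i‖ / 2 +
        γ i * ‖gradient f x i - gradient f z i‖ ^ 2 / 2) = N + A / 2 + Y / 2 + Z / 2 := by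
    rw [hA, hY, hZdef, Finset.sum_div, Finset.sum_div, Finset.sum_div, ← Finset.sum_add_distrib,
      ← Finset.sum_add_distrib, ← Finset.sum_add_distrib]
    exact Finset.sum_congr rfl fun i _ => by ring
  rw [hsum] at h2
  have hN : 0 ≤ N := Finset.sum_nonneg fun i _ =>
    mul_nonneg (hp0 i) (mul_nonneg (inv_nonneg.2 (hγ i).le) (sq_nonneg _))
  have hZ0 : 0 ≤ Z := Finset.sum_nonneg fun i _ =>
    mul_nonneg (hp0 i) (mul_nonneg (hγ i).le (sq_nonneg _))
  have h5 : C * (N + A / 2 + Y / 2 + Z / 2) ≤ κ * η * (N + A / 2 + Y / 2 + Z / 2) :=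
    mul_le_mul_of_nonneg_right hκC (by linarith)
  have hκ0 : 0 ≤ κ := zero_le_one.trans hκ1
  have h6 := mul_le_mul_of_nonneg_left h1 hκ0
  have h7 : κ * (η * (A / 2 + Y / 2)) ≤ κ * (A + Y) := by
    refine mul_le_mul_of_nonneg_left ?_ hκ0
    nlinarith
  have h8 := mul_le_mul_of_nonneg_left h3 hκ0
  have h9 := mul_le_mul_of_nonneg_left h4' (mul_nonneg hκ0 hη0)
  have h10 : β ≤ κ * β := le_mul_of_one_le_left hβ hκ1
  have h11 := mul_le_mul_of_nonneg_left (mul_le_mul_of_nonneg_left hSQ' K.coe_nonneg) hpm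
  linarith

/-- The step without delay: gap and decrease in terms of the same quantity `β`. -/
theorem exists_surplus_of_no_delay (hconv : ConvexOn ℝ Set.univ f) (hf : Differentiable ℝ f)
    (hg : ∀ i, ProperConvexLSC (g i)) {γ : Fin m → ℝ} (hγ : ∀ i, 0 < γ i)
    {L : Fin m → ℝ≥0} {K : ℝ≥0}
    (hL : ∀ x i, LipschitzWith (L i) fun v : H i => (gradient f (setBlock x i v)) i)
    (hK : ∀ x i, LipschitzWith K fun v : H i => gradient f (setBlock x i v))
    {X : Set (PiLp 2 H)} {C : ℝ} (hC : 0 < C) (heb : LuoTsengErrorBound f g γ X C)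
    {xm : PiLp 2 H} (hxm : xm ∈ argminSet (objective f g))
    {p : Fin m → ℝ} (hp1 : ∑ i, p i = 1) {pm : ℝ} (hpm : 0 ≤ pm) (hp : ∀ i, pm ≤ p i)
    {η u : ℝ} {τ : ℕ}
    (hη : ∀ i, L i * γ i + 2 * γ i * τ * K * u ≤ 2 - 2 * η) {x xb : PiLp 2 H}
    (hxX : x ∈ X) (hx : ∀ i, g i (x i) ≠ ⊤)
    (hfb : ∀ i, IsForwardBackward (γ i) (g i) (x i) (gradient f x i) (xb i)) :
    ∃ β : ℝ, pm * (objR f g x - objR f g xm) ≤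
        β + C * ∑ i, p i * ((γ i)⁻¹ * ‖x i - xb i‖ ^ 2) ∧
      ∑ i, p i * objR f g (setBlock x i (xb i)) ≤ objR f g x - β -
        η * ∑ i, p i * ((γ i)⁻¹ * ‖x i - xb i‖ ^ 2) -
        τ * K * u * ∑ i, p i * ‖x i - xb i‖ ^ 2 := by
  have hp0 : ∀ i, 0 ≤ p i := fun i => hpm.trans (hp i)
  have h1 := sum_objR_setBlock_le (g := g) hf hγ hL hp0 hp1 (η := η) (c := τ * K * u / 2)
    (fun i => by linarith [hη i]) x (gradient f x) xb
  have h2 := mul_objR_sub_le hconv hf hg hγ hK hC heb hxm hpm hp hxX hx hfb (S := 0) (by simp)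
  simp only [sub_self, inner_zero_left, norm_zero, zero_mul, zero_div, add_zero, mul_zero,
    Finset.sum_const_zero, ne_eq, OfNat.ofNat_ne_zero, not_false_eq_true, zero_pow] at h1 h2
  refine ⟨_, h2, ?_⟩
  linarith

end OneStep

/-! ### Linear rates for delayed recursions -/

section Rate

/-- The sum of `M h` over the last `τ` indices `h` before `k`. -/
def windowSum (τ : ℕ) (M : ℕ → ℝ) (k : ℕ) : ℝ :=
  ∑ h ∈ (Finset.range k).filter (fun h => k ≤ h + τ), M h

/-- The Lyapunov sequence `G k + c ∑ (τ - (k - 1 - h)) M h`, the sum being over the last `τ` indices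
`h` before `k`: the truncated subtraction gives weight zero to the earlier ones. -/
def lyapunov (τ : ℕ) (c : ℝ) (G M : ℕ → ℝ) (k : ℕ) : ℝ :=
  G k + c * ∑ h ∈ Finset.range k, ((h + τ + 1 - k : ℕ) : ℝ) * M h

variable {τ : ℕ} {c : ℝ} {G M N : ℕ → ℝ}

theorem lyapunov_succ (k : ℕ) :
    lyapunov τ c G M (k + 1) =
      lyapunov τ c G M k + (G (k + 1) - G k) + c * (τ * M k - windowSum τ M k) := by
  have h1 : ∑ h ∈ Finset.range k, ((h + τ + 1 - (k + 1) : ℕ) : ℝ) * M h =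
      ∑ h ∈ Finset.range k, ((h + τ + 1 - k : ℕ) : ℝ) * M h - windowSum τ M k := by
    rw [windowSum, Finset.sum_filter, ← Finset.sum_sub_distrib]
    refine Finset.sum_congr rfl fun h _ => ?_
    split_ifs with hk
    · have : h + τ + 1 - k = (h + τ + 1 - (k + 1)) + 1 := by omega
      rw [this]
      push_cast
      ring
    · have h2 : h + τ + 1 - k = 0 := by omega
      have h3 : h + τ + 1 - (k + 1) = 0 := by omega
      rw [h2, h3]
      simp
  have h4 : k + τ + 1 - (k + 1) = τ := by omega
  rw [lyapunov, lyapunov, Finset.sum_range_succ, h1, h4]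
  ring

theorem le_lyapunov (hc : 0 ≤ c) (hM : ∀ k, 0 ≤ M k) (k : ℕ) : G k ≤ lyapunov τ c G M k :=
  le_add_of_nonneg_right (mul_nonneg hc (Finset.sum_nonneg fun h _ =>
    mul_nonneg (Nat.cast_nonneg _) (hM h)))

theorem lyapunov_le (hc : 0 ≤ c) (hM : ∀ k, 0 ≤ M k) (k : ℕ) :
    lyapunov τ c G M k ≤ G k + c * (τ * windowSum τ M k) := by
  refine add_le_add le_rfl (mul_le_mul_of_nonneg_left ?_ hc)
  rw [windowSum, Finset.sum_filter, Finset.mul_sum]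
  refine Finset.sum_le_sum fun h hh => ?_
  rw [Finset.mem_range] at hh
  split_ifs with hk
  · refine mul_le_mul_of_nonneg_right ?_ (hM h)
    exact_mod_cast (by omega : h + τ + 1 - k ≤ τ)
  · have h2 : h + τ + 1 - k = 0 := by omega
    rw [h2]
    simp

theorem windowSum_add (j : ℕ) :
    windowSum τ M (j + τ) = ∑ i ∈ Finset.range τ, M (j + i) := by
  have h1 : (Finset.range (j + τ)).filter (fun h => j + τ ≤ h + τ) = Finset.Ico j (j + τ) := by
    ext h
    simp only [Finset.mem_filter, Finset.mem_range, Finset.mem_Ico]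
    omega
  rw [windowSum, h1, Finset.sum_Ico_eq_sum_range, add_tsub_cancel_left]

theorem lyapunov_succ_le {η : ℝ}
    (hdec : ∀ k, G (k + 1) ≤ G k - η * N k - c * (τ * M k - windowSum τ M k)) (k : ℕ) :
    lyapunov τ c G M (k + 1) ≤ lyapunov τ c G M k - η * N k := by
  rw [lyapunov_succ]
  linarith [hdec k]

/-- A decrease that bounds the gap up to the previous `τ` step lengths gives a linear rate per
`τ + 1` steps. The exceptional case `lyapunov 1 ≤ 0` is that of termination in one step. -/
theorem lyapunov_le_pow_mul {η gM pm κ θ E ρ : ℝ} (hc : 0 ≤ c) (hη : 0 < η) (hpm : 0 ≤ pm)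
    (hE : 0 ≤ E) (hG : ∀ k, 0 ≤ G k) (hM : ∀ k, 0 ≤ M k) (hN : ∀ k, 0 ≤ N k)
    (hMN : ∀ k, M k ≤ gM * N k) (hθ : 0 ≤ θ) (hκθ : 0 < κ + θ) (hpmκ : pm ≤ κ)
    (hgM : 0 ≤ gM)
    (hdec : ∀ k, G (k + 1) ≤ G k - η * N k - c * (τ * M k - windowSum τ M k))
    (hgap : ∀ k, pm * G k ≤ κ * (G k - G (k + 1) + c * (windowSum τ M k - τ * M k)) +
      E * windowSum τ M k)
    (hconst : (E + pm * c * τ) * gM ≤ η * (κ + θ - pm) ∨ lyapunov τ c G M 1 ≤ 0)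
    (hρ : ρ = 1 - pm / (κ + θ)) (k : ℕ) :
    lyapunov τ c G M k ≤ ρ ^ (k / (τ + 1)) * G 0 := by
  set a := lyapunov τ c G M with ha
  have hstep : ∀ k, a (k + 1) ≤ a k - η * N k := lyapunov_succ_le hdec
  have hanti : Antitone a := antitone_nat_of_succ_le fun k =>
    (hstep k).trans (sub_le_self _ (mul_nonneg hη.le (hN k)))
  have ha0 : a 0 = G 0 := by simp [ha, lyapunov]
  have hρ0 : 0 ≤ ρ := by
    rw [hρ, sub_nonneg, div_le_one hκθ]
    linarith
  rcases hconst with hconst | hone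
  · have hwin : ∀ j, a (j + τ + 1) ≤ ρ * a j := by
      intro j
      have h1 := hgap (j + τ)
      have h2 : a (j + τ) ≤ G (j + τ) + c * (τ * windowSum τ M (j + τ)) := lyapunov_le hc hM _
      have h3 : a (j + τ + 1) = a (j + τ) + (G (j + τ + 1) - G (j + τ)) +
        c * (τ * M (j + τ) - windowSum τ M (j + τ)) := lyapunov_succ _
      have h4 : η * windowSum τ M (j + τ) ≤ gM * (a j - a (j + τ)) := by
        rw [windowSum_add]
        have h5 := Finset.sum_range_sub' (fun i => a (j + i)) τ
        simp only [add_zero] at h5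
        rw [← h5, Finset.mul_sum, Finset.mul_sum]
        refine Finset.sum_le_sum fun i _ => ?_
        have h6 := hstep (j + i)
        have h7 := mul_le_mul_of_nonneg_left (hMN (j + i)) hη.le
        have h8 := mul_le_mul_of_nonneg_left
          (show η * N (j + i) ≤ a (j + i) - a (j + (i + 1)) by rw [← add_assoc]; linarith) hgM
        linarith
      have hE' : 0 ≤ E + pm * c * τ := by positivity
      have h5 : 0 ≤ a j - a (j + τ) := sub_nonneg.2 (hanti (Nat.le_add_right j τ))
      have h6 : η * ((E + pm * c * τ) * windowSum τ M (j + τ)) ≤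
          η * ((κ + θ - pm) * (a j - a (j + τ))) := by
        have h7 := mul_le_mul_of_nonneg_left h4 hE'
        have h8 := mul_le_mul_of_nonneg_right hconst h5
        linarith
      have h7 := le_of_mul_le_mul_left h6 hη
      have h8 := mul_le_mul_of_nonneg_left h2 hpm
      have h9 : a (j + τ + 1) ≤ a (j + τ) := hanti (Nat.le_succ _)
      have h10 := mul_nonneg hθ (sub_nonneg.2 h9)
      have h11 : κ * (a (j + τ) - a (j + τ + 1)) = κ * (G (j + τ) - G (j + τ + 1) +
          c * (windowSum τ M (j + τ) - τ * M (j + τ))) := by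
        rw [h3]
        ring
      have h12 : pm * a j ≤ (κ + θ) * (a j - a (j + τ + 1)) := by linarith
      have h13 : pm / (κ + θ) * a j ≤ a j - a (j + τ + 1) := by
        rw [div_mul_eq_mul_div, div_le_iff₀ hκθ]
        linarith
      rw [hρ]
      linarith
    have hpow : ∀ n : ℕ, a (n * (τ + 1)) ≤ ρ ^ n * G 0 := by
      intro n
      induction n with
      | zero => simp [ha0]
      | succ n ih =>
        have h1 : (n + 1) * (τ + 1) = n * (τ + 1) + τ + 1 := by ring
        rw [h1, pow_succ]
        have h2 := mul_le_mul_of_nonneg_left ih hρ0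
        linarith [hwin (n * (τ + 1))]
    exact (hanti (Nat.div_mul_le_self k (τ + 1))).trans (hpow _)
  · have hrhs : 0 ≤ ρ ^ (k / (τ + 1)) * G 0 := mul_nonneg (pow_nonneg hρ0 _) (hG 0)
    rcases Nat.eq_zero_or_pos k with rfl | hk
    · simp [ha0]
    · exact ((hanti hk).trans hone).trans hrhs

end Rate

/-! ### Random variables that depend on finitely many selections -/

section Past

variable {Ω ι : Type*} {s : ℕ → Ω → ι}

/-- `Ψ` is a function of the selections made before time `k`. -/
def DependsOnPast {E : Type*} (s : ℕ → Ω → ι) (k : ℕ) (Ψ : Ω → E) : Prop :=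
  ∀ ω ω', (∀ j < k, s j ω = s j ω') → Ψ ω = Ψ ω'

theorem DependsOnPast.exists_eq_comp {E : Type*} [Nonempty E] {k : ℕ} {Ψ : Ω → E}
    (h : DependsOnPast s k Ψ) :
    ∃ φ : ((j : Finset.range k) → ι) → E, Ψ = fun ω => φ fun j => s j ω := by
  have hf : Function.FactorsThrough Ψ fun ω (j : Finset.range k) => s j ω := fun ω ω' hω =>
    h ω ω' fun j hj => congrFun hω ⟨j, Finset.mem_range.2 hj⟩
  refine ⟨Function.extend (fun ω (j : Finset.range k) => s j ω) Ψ
    fun _ => Classical.arbitrary E, funext fun ω => ?_⟩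
  exact (hf.extend_apply _ ω).symm

variable [MeasurableSpace Ω] [Finite ι] [MeasurableSpace ι] [MeasurableSingletonClass ι]

theorem DependsOnPast.stronglyMeasurable {E : Type*} [TopologicalSpace E] [Nonempty E]
    (hs : ∀ k, Measurable (s k)) {k : ℕ} {Ψ : Ω → E} (h : DependsOnPast s k Ψ) :
    StronglyMeasurable Ψ := by
  obtain ⟨φ, rfl⟩ := h.exists_eq_comp
  exact (StronglyMeasurable.of_discrete (f := φ)).comp_measurable
    (measurable_pi_lambda _ fun j => hs j)

theorem DependsOnPast.integrable {E : Type*} [NormedAddCommGroup E]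
    (hs : ∀ k, Measurable (s k)) {P : Measure Ω} [IsFiniteMeasure P] {k : ℕ} {Ψ : Ω → E}
    (h : DependsOnPast s k Ψ) : Integrable Ψ P := by
  obtain ⟨φ, rfl⟩ := h.exists_eq_comp
  have hm : Measurable fun ω (j : Finset.range k) => s j ω := measurable_pi_lambda _ fun j => hs j
  have h1 : Integrable φ (P.map fun ω (j : Finset.range k) => s j ω) := Integrable.of_finite
  exact h1.comp_measurable hm

/-- The selection at time `k` is independent of the earlier ones, so it can be averaged out. -/
theorem integral_selected [Fintype ι] (hs : ∀ k, Measurable (s k)) {P : Measure Ω}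
    [IsProbabilityMeasure P] (hind : iIndepFun s P) {p : ι → ℝ}
    (hp : ∀ k i, P.real {ω | s k ω = i} = p i) {k : ℕ} {Ψ : ι → Ω → ℝ}
    (h : ∀ i, DependsOnPast s k (Ψ i)) :
    ∫ ω, Ψ (s k ω) ω ∂P = ∫ ω, ∑ i, p i * Ψ i ω ∂P := by
  classical
  have hsplit : ∀ ω, Ψ (s k ω) ω = ∑ i, Ψ i ω * (if s k ω = i then (1 : ℝ) else 0) := by
    intro ω
    simp
  have hmk : ∀ i, MeasurableSet {ω | s k ω = i} := fun i => hs k (measurableSet_singleton i)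
  have hprod : ∀ i, ∫ ω, Ψ i ω * (if s k ω = i then (1 : ℝ) else 0) ∂P =
      ∫ ω, p i * Ψ i ω ∂P := by
    intro i
    obtain ⟨φ, hφ⟩ := (h i).exists_eq_comp
    have hdisj : Disjoint (Finset.range k) {k} := by simp
    have h1 := hind.indepFun_finset _ _ hdisj hs
    set ψ : (({k} : Finset ℕ) → ι) → ℝ := fun v =>
      if v ⟨k, Finset.mem_singleton_self k⟩ = i then 1 else 0 with hψ
    have h2 := h1.comp (φ := φ) (ψ := ψ) (measurable_of_countable _) (measurable_of_countable _)
    have h3 := h2.integral_fun_mul_eq_mul_integral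
      ((measurable_of_countable φ).comp (measurable_pi_lambda _ fun j => hs j)).aestronglyMeasurable
      ((measurable_of_countable ψ).comp
        (measurable_pi_lambda _ fun j : ({k} : Finset ℕ) => hs j)).aestronglyMeasurable
    simp only [Function.comp_apply, hψ] at h3
    rw [hφ, h3, integral_const_mul, mul_comm]
    congr 1
    rw [← hp k i, ← integral_indicator_one (hmk i)]
    refine integral_congr_ae (Eventually.of_forall fun ω => ?_)
    simp [Set.indicator_apply]
  have hdep : ∀ i, DependsOnPast s (k + 1)
      fun ω => Ψ i ω * (if s k ω = i then (1 : ℝ) else 0) := by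
    intro i ω ω' hω
    simp only [h i ω ω' fun j hj => hω j (by omega), hω k (Nat.lt_succ_self k)]
  have hdep' : ∀ i, DependsOnPast s k fun ω => p i * Ψ i ω := fun i ω ω' hω => by
    simp only [h i ω ω' hω]
  simp_rw [hsplit]
  rw [integral_finsetSum _ fun i _ => (hdep i).integrable hs,
    integral_finsetSum _ fun i _ => (hdep' i).integrable hs]
  exact Finset.sum_congr rfl fun i _ => hprod i

end Past

/-! ### Trajectories -/

theorem card_window_le (τ k : ℕ) :
    ((Finset.range k).filter (fun h => k ≤ h + τ)).card ≤ τ := by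
  refine (Finset.card_le_card (t := Finset.Ico (k - τ) k) fun h hh => ?_).trans ?_
  · simp only [Finset.mem_Ico, Finset.mem_filter, Finset.mem_range] at hh ⊢
    omega
  · rw [Nat.card_Ico]
    omega

theorem two_mul_windowSum_mul_le (τ : ℕ) (D : ℕ → ℝ) (k : ℕ) (v : ℝ) :
    2 * windowSum τ D k * v ≤ windowSum τ (fun h => D h ^ 2) k + τ * v ^ 2 := by
  have h1 : 2 * windowSum τ D k * v ≤ windowSum τ (fun h => D h ^ 2) k +
      ((Finset.range k).filter (fun h => k ≤ h + τ)).card * v ^ 2 := by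
    rw [windowSum, windowSum, mul_assoc, Finset.sum_mul, Finset.mul_sum, ← nsmul_eq_mul,
      ← Finset.sum_const, ← Finset.sum_add_distrib]
    refine Finset.sum_le_sum fun h _ => ?_
    rw [← mul_assoc]
    exact two_mul_le_add_sq _ _
  have h2 : (((Finset.range k).filter (fun h => k ≤ h + τ)).card : ℝ) ≤ τ :=
    Nat.cast_le.2 (card_window_le τ k)
  linarith [mul_le_mul_of_nonneg_right h2 (sq_nonneg v)]

theorem windowSum_sq_le (τ : ℕ) (D : ℕ → ℝ) (k : ℕ) :
    windowSum τ D k ^ 2 ≤ τ * windowSum τ (fun h => D h ^ 2) k :=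
  sq_sum_le_card_mul_sum_sq.trans (mul_le_mul_of_nonneg_right
    (Nat.cast_le.2 (card_window_le τ k)) (Finset.sum_nonneg fun _ _ => sq_nonneg _))

section Trajectory

variable {m : ℕ} {H : Fin m → Type*} [∀ i, NormedAddCommGroup (H i)]

theorem sum_norm_setBlock_sub (x : PiLp 2 H) (i : Fin m) (v : H i) (φ : Fin m → ℝ → ℝ)
    (hφ : ∀ i, φ i 0 = 0) : ∑ j, φ j ‖(setBlock x i v - x) j‖ = φ i ‖v - x i‖ := by
  rw [Finset.sum_eq_single i]
  · simp
  · intro j _ hj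
    simp [setBlock_apply_of_ne x hj, hφ]
  · simp

theorem norm_setBlock_sub_sq (x : PiLp 2 H) (i : Fin m) (v : H i) :
    ‖setBlock x i v - x‖ ^ 2 = ‖x i - v‖ ^ 2 := by
  rw [PiLp.norm_sq_eq_of_L2, sum_norm_setBlock_sub x i v (fun _ r => r ^ 2) (by simp),
    norm_sub_rev]

theorem normW_setBlock_sub_sq {a : Fin m → ℝ} (ha : ∀ i, 0 ≤ a i) (x : PiLp 2 H) (i : Fin m)
    (v : H i) : normW a (setBlock x i v - x) ^ 2 = a i * ‖x i - v‖ ^ 2 := by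
  rw [normW_sq ha, sum_norm_setBlock_sub x i v (fun j r => a j * r ^ 2) (by simp),
    norm_sub_rev]

variable [∀ i, InnerProductSpace ℝ (H i)] [∀ i, CompleteSpace (H i)]

/-- The point that results from updating all blocks at time `k` along the trajectory `y`. -/
noncomputable def fullUpdate (f : PiLp 2 H → ℝ) (g : ∀ i, H i → EReal) (γ : Fin m → ℝ)
    (d : ℕ → Fin m → ℕ) (y : ℕ → PiLp 2 H) (k : ℕ) : PiLp 2 H :=
  WithLp.toLp 2 fun i => prox (fun z => (γ i : EReal) * g i z)
    (y k i - γ i • gradient f (delayed y k (d k)) i)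

variable {f : PiLp 2 H → ℝ} {g : ∀ i, H i → EReal} {γ : Fin m → ℝ} {d : ℕ → Fin m → ℕ}
  {x0 : PiLp 2 H} {σ : ℕ → Fin m} {y : ℕ → PiLp 2 H}

theorem isForwardBackward_fullUpdate (hg : ∀ i, ProperConvexLSC (g i)) (hγ : ∀ i, 0 < γ i)
    (y : ℕ → PiLp 2 H) (k : ℕ) (i : Fin m) :
    IsForwardBackward (γ i) (g i) (y k i) (gradient f (delayed y k (d k)) i)
      (fullUpdate f g γ d y k i) :=
  isForwardBackward_prox (hγ i) (hg i) _ _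

theorem IsGenerated.succ_eq (h : IsGenerated f g γ d x0 σ y) (k : ℕ) :
    y (k + 1) = setBlock (y k) (σ k) (fullUpdate f g γ d y k (σ k)) := by
  rw [eq_setBlock (h.other k), h.selected k]
  rfl

theorem IsGenerated.ne_top (h : IsGenerated f g γ d x0 σ y) (hg : ∀ i, ProperConvexLSC (g i))
    (hγ : ∀ i, 0 < γ i) (hx0 : ∀ i, g i (x0 i) ≠ ⊤) (k : ℕ) (i : Fin m) : g i (y k i) ≠ ⊤ := by
  induction k with
  | zero =>
    rw [h.init]
    exact hx0 i
  | succ k ih =>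
    by_cases hi : i = σ k
    · subst hi
      rw [h.succ_eq k, setBlock_apply_self]
      exact (isForwardBackward_fullUpdate hg hγ y k _).ne_top
    · rwa [h.other k i hi]

/-- The delayed point is within the total length of the last `τ` steps. -/
theorem IsGenerated.sum_norm_sub_delayed_le (h : IsGenerated f g γ d x0 σ y) {τ : ℕ}
    (hd : ∀ k i, d k i ≤ min k τ) (k : ℕ) :
    ∑ i, ‖y k i - delayed y k (d k) i‖ ≤ windowSum τ (fun n => ‖y (n + 1) - y n‖) k := by
  have h1 : ∀ i, ‖y k i - delayed y k (d k) i‖ ≤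
      ∑ n ∈ (Finset.range k).filter (fun n => k ≤ n + τ), ‖(y (n + 1) - y n) i‖ := by
    intro i
    obtain ⟨hdk, hdτ⟩ := le_min_iff.1 (hd k i)
    have h2 : y k i - delayed y k (d k) i = ∑ n ∈ Finset.Ico (k - d k i) k, (y (n + 1) - y n) i := by
      have := Finset.sum_Ico_sub (fun n => y n i) (Nat.sub_le k (d k i))
      simp only [delayed, PiLp.sub_apply]
      exact this.symm
    rw [h2]
    refine (norm_sum_le _ _).trans (Finset.sum_le_sum_of_subset_of_nonneg (fun n hn => ?_)
      fun _ _ _ => norm_nonneg _)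
    simp only [Finset.mem_Ico, Finset.mem_filter, Finset.mem_range] at hn ⊢
    omega
  refine (Finset.sum_le_sum fun i _ => h1 i).trans (le_of_eq ?_)
  rw [Finset.sum_comm, windowSum]
  refine Finset.sum_congr rfl fun n _ => ?_
  rw [h.succ_eq n, sum_norm_setBlock_sub _ _ _ (fun _ r => r) (by simp)]
  refine (sq_eq_sq₀ (norm_nonneg _) (norm_nonneg _)).1 ?_
  rw [norm_setBlock_sub_sq, norm_sub_rev]

theorem fullUpdate_congr {y y' : ℕ → PiLp 2 H} {k : ℕ} (h : ∀ j ≤ k, y j = y' j) :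
    fullUpdate f g γ d y k = fullUpdate f g γ d y' k := by
  have h1 : delayed y k (d k) = delayed y' k (d k) := by
    unfold delayed
    simp only [h _ (Nat.sub_le k _)]
  unfold fullUpdate
  rw [h1, h k le_rfl]

theorem IsGenerated.eq_of_eq {σ' : ℕ → Fin m} {y' : ℕ → PiLp 2 H}
    (h : IsGenerated f g γ d x0 σ y) (h' : IsGenerated f g γ d x0 σ' y') {k : ℕ}
    (hσ : ∀ j < k, σ j = σ' j) : ∀ j ≤ k, y j = y' j := by
  intro j
  induction j using Nat.strong_induction_on with
  | _ j ih =>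
    intro hj
    rcases j with _ | j
    · rw [h.init, h'.init]
    · have hy : ∀ l ≤ j, y l = y' l := fun l hl => ih l (by omega) (by omega)
      rw [h.succ_eq, h'.succ_eq, hσ j (by omega), hy j le_rfl, fullUpdate_congr hy]

end Trajectory

section Expectation

variable {m : ℕ} {H : Fin m → Type*} [∀ i, NormedAddCommGroup (H i)]
  [∀ i, InnerProductSpace ℝ (H i)] [∀ i, CompleteSpace (H i)]
  {f : PiLp 2 H → ℝ} {g : ∀ i, H i → EReal} {γ : Fin m → ℝ} {d : ℕ → Fin m → ℕ}
  {x0 : PiLp 2 H} {Ω : Type*} {s : ℕ → Ω → Fin m} {x : ℕ → Ω → PiLp 2 H}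

theorem dependsOnPast_iterate
    (hx : ∀ ω, IsGenerated f g γ d x0 (fun k => s k ω) fun k => x k ω) {j k : ℕ} (hj : j ≤ k) :
    DependsOnPast s k (x j) :=
  fun ω ω' h => (hx ω).eq_of_eq (hx ω') h j hj

theorem dependsOnPast_fullUpdate
    (hx : ∀ ω, IsGenerated f g γ d x0 (fun k => s k ω) fun k => x k ω) (k : ℕ) :
    DependsOnPast s k fun ω => fullUpdate f g γ d (fun k => x k ω) k :=
  fun ω ω' h => fullUpdate_congr ((hx ω).eq_of_eq (hx ω') h)

variable [MeasurableSpace Ω] {P : Measure Ω} [IsProbabilityMeasure P] {p : Fin m → ℝ}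

/-- The expected value of a function of the next iterate. -/
theorem integral_next (hs : ∀ k, Measurable (s k)) (hind : iIndepFun s P)
    (hp : ∀ k i, P.real {ω | s k ω = i} = p i)
    (hx : ∀ ω, IsGenerated f g γ d x0 (fun k => s k ω) fun k => x k ω)
    (Φ : PiLp 2 H → PiLp 2 H → ℝ) (k : ℕ) :
    ∫ ω, Φ (x (k + 1) ω) (x k ω) ∂P = ∫ ω, ∑ i, p i *
      Φ (setBlock (x k ω) i (fullUpdate f g γ d (fun k => x k ω) k i)) (x k ω) ∂P := by
  rw [← integral_selected hs hind hp (k := k) (Ψ := fun i ω =>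
    Φ (setBlock (x k ω) i (fullUpdate f g γ d (fun k => x k ω) k i)) (x k ω))]
  · simp only [fun ω => (hx ω).succ_eq k]
  · intro i ω ω' h
    have h1 := dependsOnPast_iterate hx le_rfl ω ω' h
    have h2 := dependsOnPast_fullUpdate hx k ω ω' h
    simp only at h2
    simp only [h1, h2]

theorem sum_eq_one (hs : ∀ k, Measurable (s k)) (hp : ∀ k i, P.real {ω | s k ω = i} = p i) :
    ∑ i, p i = 1 := by
  have h := sum_measureReal_preimage_singleton (μ := P) (f := s 0) Finset.univ
    (fun i _ => hs 0 (measurableSet_singleton i))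
  simp only [Finset.coe_univ, Set.preimage_univ, probReal_univ] at h
  rw [← h]
  exact Finset.sum_congr rfl fun i _ => (hp 0 i).symm

end Expectation

/-! ### Expected decrease and expected gap -/

theorem affine_integral_nonpos {Ω : Type*} [MeasurableSpace Ω] {P : Measure Ω}
    [IsProbabilityMeasure P] {X₀ X₁ X₂ X₃ X₄ : Ω → ℝ} (h₀ : Integrable X₀ P)
    (h₁ : Integrable X₁ P) (h₂ : Integrable X₂ P) (h₃ : Integrable X₃ P) (h₄ : Integrable X₄ P)
    {b b₀ b₁ b₂ b₃ b₄ : ℝ}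
    (h : ∀ᵐ ω ∂P, b + b₀ * X₀ ω + b₁ * X₁ ω + b₂ * X₂ ω + b₃ * X₃ ω + b₄ * X₄ ω ≤ 0) :
    b + b₀ * ∫ ω, X₀ ω ∂P + b₁ * ∫ ω, X₁ ω ∂P + b₂ * ∫ ω, X₂ ω ∂P + b₃ * ∫ ω, X₃ ω ∂P +
      b₄ * ∫ ω, X₄ ω ∂P ≤ 0 := by
  have j₀ : Integrable (fun ω => b + b₀ * X₀ ω) P := (integrable_const b).add (h₀.const_mul b₀)
  have j₁ : Integrable (fun ω => b + b₀ * X₀ ω + b₁ * X₁ ω) P := j₀.add (h₁.const_mul b₁)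
  have j₂ : Integrable (fun ω => b + b₀ * X₀ ω + b₁ * X₁ ω + b₂ * X₂ ω) P :=
    j₁.add (h₂.const_mul b₂)
  have j₃ : Integrable (fun ω => b + b₀ * X₀ ω + b₁ * X₁ ω + b₂ * X₂ ω + b₃ * X₃ ω) P :=
    j₂.add (h₃.const_mul b₃)
  have hint := integral_nonpos_of_ae h
  rw [integral_add j₃ (h₄.const_mul b₄), integral_add j₂ (h₃.const_mul b₃),
    integral_add j₁ (h₂.const_mul b₂), integral_add j₀ (h₁.const_mul b₁),
    integral_add (integrable_const b) (h₀.const_mul b₀)] at hint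
  simpa only [integral_const, integral_const_mul, probReal_univ, one_smul] using hint

section Expectation

variable {m : ℕ} {H : Fin m → Type*} [∀ i, NormedAddCommGroup (H i)]
  [∀ i, InnerProductSpace ℝ (H i)] [∀ i, CompleteSpace (H i)]
  {f : PiLp 2 H → ℝ} {g : ∀ i, H i → EReal} {γ : Fin m → ℝ} {d : ℕ → Fin m → ℕ}
  {x0 : PiLp 2 H} {Ω : Type*} {s : ℕ → Ω → Fin m} {x : ℕ → Ω → PiLp 2 H}

theorem dependsOnPast_of_history
    (hx : ∀ ω, IsGenerated f g γ d x0 (fun k => s k ω) fun k => x k ω) {k : ℕ} {E : Type*}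
    {Ψ : (ℕ → PiLp 2 H) → E} (hΨ : ∀ y y', (∀ j ≤ k, y j = y' j) → Ψ y = Ψ y') :
    DependsOnPast s k fun ω => Ψ fun k => x k ω :=
  fun ω ω' h => hΨ _ _ ((hx ω).eq_of_eq (hx ω') h)

variable [MeasurableSpace Ω] {P : Measure Ω} [IsProbabilityMeasure P] {p : Fin m → ℝ}

theorem integrable_of_history (hs : ∀ k, Measurable (s k))
    (hx : ∀ ω, IsGenerated f g γ d x0 (fun k => s k ω) fun k => x k ω) (k : ℕ)
    (Ψ : (ℕ → PiLp 2 H) → ℝ) (hΨ : ∀ y y', (∀ j ≤ k, y j = y' j) → Ψ y = Ψ y') :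
    Integrable (fun ω => Ψ fun k => x k ω) P :=
  (dependsOnPast_of_history hx hΨ).integrable hs

theorem integral_windowSum (hs : ∀ k, Measurable (s k))
    (hx : ∀ ω, IsGenerated f g γ d x0 (fun k => s k ω) fun k => x k ω) (τ k : ℕ)
    (Φ : PiLp 2 H → PiLp 2 H → ℝ) :
    ∫ ω, windowSum τ (fun n => Φ (x (n + 1) ω) (x n ω)) k ∂P =
      windowSum τ (fun n => ∫ ω, Φ (x (n + 1) ω) (x n ω) ∂P) k := by
  unfold windowSum
  refine integral_finsetSum _ fun n _ => integrable_of_history hs hx (n + 1)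
    (fun y => Φ (y (n + 1)) (y n)) fun y y' h => ?_
  simp only [h _ le_rfl, h n (Nat.le_succ n)]

/-- An affine inequality between the quantities of one step survives taking expectations. -/
theorem integral_step_le (hs : ∀ k, Measurable (s k)) (hind : iIndepFun s P)
    (hp : ∀ k i, P.real {ω | s k ω = i} = p i) (hγ : ∀ i, 0 < γ i)
    (hx : ∀ ω, IsGenerated f g γ d x0 (fun k => s k ω) fun k => x k ω) (τ k : ℕ)
    {b b₀ b₁ b₂ b₃ b₄ : ℝ}
    (h : ∀ᵐ ω ∂P, b + b₀ * objR f g (x k ω) + b₁ * ∑ i, p i * objR f g (setBlock (x k ω) i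
        (fullUpdate f g γ d (fun k => x k ω) k i)) +
      b₂ * ∑ i, p i * ((γ i)⁻¹ * ‖x k ω i - fullUpdate f g γ d (fun k => x k ω) k i‖ ^ 2) +
      b₃ * ∑ i, p i * ‖x k ω i - fullUpdate f g γ d (fun k => x k ω) k i‖ ^ 2 +
      b₄ * windowSum τ (fun n => ‖x (n + 1) ω - x n ω‖ ^ 2) k ≤ 0) :
    b + b₀ * ∫ ω, objR f g (x k ω) ∂P + b₁ * ∫ ω, objR f g (x (k + 1) ω) ∂P +
      b₂ * ∫ ω, normW (fun i => (γ i)⁻¹) (x (k + 1) ω - x k ω) ^ 2 ∂P +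
      b₃ * ∫ ω, ‖x (k + 1) ω - x k ω‖ ^ 2 ∂P +
      b₄ * windowSum τ (fun n => ∫ ω, ‖x (n + 1) ω - x n ω‖ ^ 2 ∂P) k ≤ 0 := by
  have ha : ∀ i, 0 ≤ (γ i)⁻¹ := fun i => (inv_pos.2 (hγ i)).le
  have e1 := integral_next hs hind hp hx (fun y _ => objR f g y) k
  have e2 := integral_next hs hind hp hx (fun y z => normW (fun i => (γ i)⁻¹) (y - z) ^ 2) k
  have e3 := integral_next hs hind hp hx (fun y z => ‖y - z‖ ^ 2) k
  have e4 := integral_windowSum (P := P) hs hx τ k (fun y z => ‖y - z‖ ^ 2)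
  simp only [normW_setBlock_sub_sq ha] at e2
  simp only [norm_setBlock_sub_sq] at e3
  rw [e1, e2, e3, ← e4]
  have i0 := integrable_of_history (P := P) hs hx k (fun y => objR f g (y k))
    fun y y' h => by simp only [h k le_rfl]
  have i1 := integrable_of_history (P := P) hs hx k
    (fun y => ∑ i, p i * objR f g (setBlock (y k) i (fullUpdate f g γ d y k i)))
    fun y y' h => by simp only [h k le_rfl, fullUpdate_congr h]
  have i2 := integrable_of_history (P := P) hs hx k
    (fun y => ∑ i, p i * ((γ i)⁻¹ * ‖y k i - fullUpdate f g γ d y k i‖ ^ 2))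
    fun y y' h => by simp only [h k le_rfl, fullUpdate_congr h]
  have i3 := integrable_of_history (P := P) hs hx k
    (fun y => ∑ i, p i * ‖y k i - fullUpdate f g γ d y k i‖ ^ 2)
    fun y y' h => by simp only [h k le_rfl, fullUpdate_congr h]
  have i4 := integrable_of_history (P := P) hs hx k
    (fun y => windowSum τ (fun n => ‖y (n + 1) - y n‖ ^ 2) k)
    fun y y' h => by
      unfold windowSum
      refine Finset.sum_congr rfl fun n hn => ?_
      have hn' := Finset.mem_range.1 (Finset.mem_filter.1 hn).1
      simp only [h (n + 1) hn', h n hn'.le]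
  exact affine_integral_nonpos i0 i1 i2 i3 i4 h

end Expectation

/-! ### The constants -/

section Constants

variable {m : ℕ} [NeZero m] {a : Fin m → ℝ}

theorem le_maxOf (a : Fin m → ℝ) (i : Fin m) : a i ≤ maxOf a :=
  Finset.le_sup' a (Finset.mem_univ i)

theorem minOf_le (a : Fin m → ℝ) (i : Fin m) : minOf a ≤ a i :=
  Finset.inf'_le a (Finset.mem_univ i)

theorem exists_eq_maxOf (a : Fin m → ℝ) : ∃ i, maxOf a = a i := by
  obtain ⟨i, -, h⟩ := Finset.exists_mem_eq_sup' Finset.univ_nonempty a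
  exact ⟨i, h⟩

theorem exists_eq_minOf (a : Fin m → ℝ) : ∃ i, minOf a = a i := by
  obtain ⟨i, -, h⟩ := Finset.exists_mem_eq_inf' Finset.univ_nonempty a
  exact ⟨i, h⟩

theorem minOf_pos (h : ∀ i, 0 < a i) : 0 < minOf a := by
  obtain ⟨i, hi⟩ := exists_eq_minOf a
  exact hi ▸ h i

theorem maxOf_pos (h : ∀ i, 0 < a i) : 0 < maxOf a := by
  obtain ⟨i, hi⟩ := exists_eq_maxOf a
  exact hi ▸ h i

theorem minOf_le_maxOf (a : Fin m → ℝ) : minOf a ≤ maxOf a :=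
  (minOf_le a 0).trans (le_maxOf a 0)

omit [NeZero m] in
theorem le_one_of_sum_eq_one {p : Fin m → ℝ} (hp : ∀ i, 0 < p i) (hp1 : ∑ i, p i = 1) (i : Fin m) :
    p i ≤ 1 :=
  hp1 ▸ Finset.single_le_sum (fun j _ => (hp j).le) (Finset.mem_univ i)

theorem le_sq_maxOf_div_sqrt {p : Fin m → ℝ} (hp : ∀ i, 0 < p i) (i : Fin m) :
    p i ≤ (maxOf p / √(minOf p)) ^ 2 := by
  have h1 := minOf_pos hp
  rw [div_pow, Real.sq_sqrt h1.le, le_div_iff₀ h1, sq]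
  exact mul_le_mul (le_maxOf p i) (minOf_le_maxOf p) h1.le (maxOf_pos hp).le

/-- Either all probabilities can be at most `1 / 2`, or there is a single block. -/
theorem minOf_le_half_or_subsingleton {p : Fin m → ℝ} (hp : ∀ i, 0 < p i) (hp1 : ∑ i, p i = 1) :
    minOf p ≤ 1 / 2 ∨ Subsingleton (Fin m) := by
  rcases subsingleton_or_nontrivial (Fin m) with h | h
  · exact Or.inr h
  · obtain ⟨i, j, hij⟩ := exists_pair_ne (Fin m)
    have h1 : ∑ k ∈ {i, j}, p k ≤ ∑ k, p k :=
      Finset.sum_le_sum_of_subset_of_nonneg (Finset.subset_univ _) fun k _ _ => (hp k).le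
    rw [Finset.sum_pair hij, hp1] at h1
    exact Or.inl (by linarith [minOf_le p i, minOf_le p j])

variable {L : Fin m → ℝ≥0} {Lres : ℝ≥0} {γ p : Fin m → ℝ} {τ : ℕ}

theorem stepsize_le_deltaC (L : Fin m → ℝ≥0) (Lres : ℝ≥0) (γ p : Fin m → ℝ) (τ : ℕ) (i : Fin m) :
    L i * γ i + 2 * γ i * τ * Lres * (maxOf p / √(minOf p)) ≤ deltaC L Lres γ p τ :=
  le_maxOf (fun i => (L i : ℝ) * γ i + 2 * γ i * τ * Lres * (maxOf p / √(minOf p))) i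

theorem two_mul_maxOf_le_deltaC (L : Fin m → ℝ≥0) (Lres : ℝ≥0) (hγ : ∀ i, 0 < γ i)
    (p : Fin m → ℝ) (τ : ℕ) :
    2 * (maxOf γ * τ * Lres * (maxOf p / √(minOf p))) ≤ deltaC L Lres γ p τ := by
  obtain ⟨i, hi⟩ := exists_eq_maxOf γ
  have h1 := stepsize_le_deltaC L Lres γ p τ i
  have h2 : 0 ≤ (L i : ℝ) * γ i := mul_nonneg (L i).coe_nonneg (hγ i).le
  rw [hi]
  linarith

theorem kappaC_eq_max {C δ : ℝ} (hδ : δ < 2) : kappaC C δ = max 1 (2 * C / (2 - δ)) := by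
  have h1 : 0 < 2 - δ := by linarith
  have h2 : 2 * C / (2 - δ) = 1 + (2 * C + δ - 2) / (2 - δ) := by
    field_simp
    ring
  rw [kappaC, h2, ← max_div_div_right h1.le, zero_div, max_comm, ← max_add_add_left, add_zero]

theorem thetaC_le {δ : ℝ} (hδ : δ = deltaC L Lres γ p τ) (hδ_lt : δ < 2) (hγ : ∀ i, 0 < γ i)
    (hp : ∀ i, 0 < p i) :
    thetaC Lres γ p τ δ ≤ √(minOf p) / (maxOf p * (2 - δ)) * (maxOf p ^ 2 / √(minOf p) + 1) := by
  have h1 : 0 < 2 - δ := by linarith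
  have h2 := maxOf_pos hp
  have h3 := Real.sqrt_pos.2 (minOf_pos hp)
  have h4 := two_mul_maxOf_le_deltaC L Lres hγ p τ
  refine mul_le_mul_of_nonneg_right ?_ (by positivity)
  rw [div_le_div_iff₀ h1 (by positivity)]
  have h5 : maxOf γ * τ * Lres * (maxOf p / √(minOf p)) ≤ 1 := by linarith
  rw [mul_div_assoc', div_le_one h3] at h5
  have h6 := mul_le_mul_of_nonneg_right h5 h1.le
  linarith

theorem thetaC_nonneg {δ : ℝ} (hδ_lt : δ < 2) (hγ : ∀ i, 0 < γ i) :
    0 ≤ thetaC Lres γ p τ δ := by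
  have h1 : 0 < 2 - δ := by linarith
  have h2 := maxOf_pos hγ
  unfold thetaC
  positivity

theorem mul_half_sq_add_one_le {κ η q : ℝ} (hη : 0 < η) (hq : 0 ≤ q) (hqη : q ≤ 1 - η)
    (h : η + q ≤ κ * η) : κ * (q ^ 2 / 2) + 1 ≤ κ := by
  have hq1 : q ≤ 1 := by linarith
  have h1 : 0 ≤ 1 - q ^ 2 / 2 := by nlinarith
  have h2 := mul_le_mul_of_nonneg_right h h1
  have h3 : (η + q) * q ^ 2 ≤ 1 * q ^ 2 :=
    mul_le_mul_of_nonneg_right (by linarith) (sq_nonneg q)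
  have h4 : q * q ≤ q * 1 := mul_le_mul_of_nonneg_left hq1 hq
  have h5 : η * 1 ≤ η * (κ * (1 - q ^ 2 / 2)) := by linarith
  have h6 := le_of_mul_le_mul_left h5 hη
  linarith

/-- The coefficient of the past step lengths is at most `κ + θ - p_min`: the second-order gradient
error is absorbed by `κ`, and the other errors by `θ`. -/
theorem absorption {κ θ η u K pm pM gM : ℝ} {τ : ℕ} (hη : 0 < η) (hκ : 0 ≤ κ) (hgM : 0 ≤ gM)
    (hu : 0 ≤ u) (hK : 0 ≤ K) (hpmM : pm ≤ pM) (hpm1 : pm ≤ 1)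
    (hθ : η * θ = τ * K * gM / 2 * (pM * u + 1))
    (h : κ * ((gM * τ * K * u) ^ 2 / 2) + pm ≤ κ) :
    (κ * η / 2 * (gM * u ^ 2 * K ^ 2 * τ) + pm * (K * τ / 2) + pm * (K * u / 2) * τ) * gM ≤
      η * (κ + θ - pm) := by
  have h1 : gM * u ^ 2 * K ^ 2 * τ * gM ≤ (gM * τ * K * u) ^ 2 := by
    have h2 : (τ : ℝ) ≤ τ ^ 2 := by exact_mod_cast Nat.le_self_pow two_ne_zero τ
    have h3 : (gM * τ * K * u) ^ 2 = gM * u ^ 2 * K ^ 2 * τ ^ 2 * gM := by ring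
    rw [h3]
    gcongr
  have h4 := mul_le_mul_of_nonneg_left h1 (show 0 ≤ κ * η / 2 by positivity)
  have h5 := mul_le_mul_of_nonneg_left h hη.le
  have h6 : τ * K * gM / 2 * (pm * u + pm) ≤ η * θ := by
    rw [hθ]
    gcongr
  linarith

end Constants

/-! ### The linear rate in expectation -/

section Rate

variable {m : ℕ} {H : Fin m → Type*} [∀ i, NormedAddCommGroup (H i)]
  [∀ i, InnerProductSpace ℝ (H i)] [∀ i, CompleteSpace (H i)]

omit [∀ i, InnerProductSpace ℝ (H i)] [∀ i, CompleteSpace (H i)] in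
theorem norm_sq_eq_mul_normW_sq_of_subsingleton [NeZero m] [Subsingleton (Fin m)] {γ : Fin m → ℝ}
    (hγ : ∀ i, 0 < γ i) (v : PiLp 2 H) :
    ‖v‖ ^ 2 = maxOf γ * normW (fun i => (γ i)⁻¹) v ^ 2 := by
  obtain ⟨i, hi⟩ := exists_eq_maxOf γ
  rw [PiLp.norm_sq_eq_of_L2, normW_sq fun i => (inv_pos.2 (hγ i)).le,
    Fintype.sum_subsingleton _ i, Fintype.sum_subsingleton _ i, hi, ← mul_assoc,
    mul_inv_cancel₀ (hγ i).ne', one_mul]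

omit [∀ i, InnerProductSpace ℝ (H i)] [∀ i, CompleteSpace (H i)] in
theorem norm_sq_le_mul_normW_sq [NeZero m] {γ : Fin m → ℝ} (hγ : ∀ i, 0 < γ i) (v : PiLp 2 H) :
    ‖v‖ ^ 2 ≤ maxOf γ * normW (fun i => (γ i)⁻¹) v ^ 2 := by
  rw [PiLp.norm_sq_eq_of_L2, normW_sq fun i => (inv_pos.2 (hγ i)).le, Finset.mul_sum]
  refine Finset.sum_le_sum fun i _ => ?_
  rw [← mul_assoc]
  refine le_mul_of_one_le_left (sq_nonneg _) ?_
  rw [← div_eq_mul_inv, one_le_div (hγ i)]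
  exact le_maxOf γ i

/-- The first step uses no delayed information, since there is no earlier iterate. -/
theorem expected_first_step [NeZero m] {f : PiLp 2 H → ℝ} {g : ∀ i, H i → EReal}
    (hconv : ConvexOn ℝ Set.univ f) (hf : Differentiable ℝ f)
    (hg : ∀ i, ProperConvexLSC (g i)) {L : Fin m → ℝ≥0} {Lres : ℝ≥0}
    (hLres : ∀ x i, LipschitzWith Lres fun v : H i => gradient f (setBlock x i v))
    (hL : ∀ x i, LipschitzWith (L i) fun v : H i => (gradient f (setBlock x i v)) i)
    {xm : PiLp 2 H} (hxm : xm ∈ argminSet (objective f g))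
    {Ω : Type*} [MeasurableSpace Ω] {P : Measure Ω} [IsProbabilityMeasure P]
    {s : ℕ → Ω → Fin m} (hs : ∀ k, Measurable (s k)) (hind : iIndepFun s P)
    {p : Fin m → ℝ} (hp_pos : ∀ i, 0 < p i) (hp : ∀ k i, P.real {ω | s k ω = i} = p i)
    {τ : ℕ} {d : ℕ → Fin m → ℕ}
    {γ : Fin m → ℝ} (hγ : ∀ i, 0 < γ i) {x0 : PiLp 2 H} (hx0 : ∀ i, g i (x0 i) ≠ ⊤)
    {x : ℕ → Ω → PiLp 2 H}
    (hx : ∀ ω, IsGenerated f g γ d x0 (fun k => s k ω) fun k => x k ω)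
    {η u : ℝ} (hη : ∀ i, L i * γ i + 2 * γ i * τ * Lres * u ≤ 2 - 2 * η)
    {X : Set (PiLp 2 H)} {C : ℝ} (hC : 0 < C) (heb : LuoTsengErrorBound f g γ X C)
    (hX : ∀ᵐ ω ∂P, ∀ k, x k ω ∈ X) :
    ∃ β : ℝ, minOf p * (∫ ω, objR f g (x 0 ω) ∂P - objR f g xm) ≤
        β + C * ∫ ω, normW (fun i => (γ i)⁻¹) (x 1 ω - x 0 ω) ^ 2 ∂P ∧
      ∫ ω, objR f g (x 1 ω) ∂P ≤ ∫ ω, objR f g (x 0 ω) ∂P - β -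
        η * ∫ ω, normW (fun i => (γ i)⁻¹) (x 1 ω - x 0 ω) ^ 2 ∂P -
        τ * Lres * u * ∫ ω, ‖x 1 ω - x 0 ω‖ ^ 2 ∂P := by
  have hinit : ∀ ω, x 0 ω = x0 := fun ω => (hx ω).init
  obtain ⟨ω₀, hω₀⟩ := hX.exists
  have hdel : delayed (fun k => x k ω₀) 0 (d 0) = x 0 ω₀ := by
    ext i
    simp [delayed]
  have hfb := isForwardBackward_fullUpdate (f := f) (d := d) hg hγ (fun k => x k ω₀) 0
  simp only [hdel] at hfb
  obtain ⟨β, hβ1, hβ2⟩ := exists_surplus_of_no_delay hconv hf hg hγ hL hLres hC heb hxm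
    (sum_eq_one hs hp) (minOf_pos hp_pos).le (minOf_le p) hη (hω₀ 0)
    (fun i => (hx ω₀).ne_top hg hγ hx0 0 i) hfb
  have hfull : ∀ ω, fullUpdate f g γ d (fun k => x k ω) 0 =
      fullUpdate f g γ d (fun k => x k ω₀) 0 := fun ω => fullUpdate_congr fun j hj => by
    simp only [Nat.le_zero.1 hj, hinit]
  have hx00 : ∀ ω, x 0 ω = x 0 ω₀ := fun ω => by rw [hinit, hinit]
  have h1 := integral_step_le hs hind hp hγ hx τ 0 (b := -(minOf p * objR f g xm) - β)
    (b₀ := minOf p) (b₁ := 0) (b₂ := -C) (b₃ := 0) (b₄ := 0) (Eventually.of_forall fun ω => by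
      rw [hfull ω, hx00 ω]
      linarith)
  have h2 := integral_step_le hs hind hp hγ hx τ 0 (b := β) (b₀ := -1) (b₁ := 1) (b₂ := η)
    (b₃ := τ * Lres * u) (b₄ := 0) (Eventually.of_forall fun ω => by
      rw [hfull ω, hx00 ω]
      linarith)
  rw [zero_add] at h1 h2
  exact ⟨β, by linarith, by linarith⟩

/-- Linear rates for the expected gap and for the expected squared step length. -/
theorem expected_rate [NeZero m] {f : PiLp 2 H → ℝ} {g : ∀ i, H i → EReal}
    (hconv : ConvexOn ℝ Set.univ f) (hf : Differentiable ℝ f)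
    (hg : ∀ i, ProperConvexLSC (g i)) {L : Fin m → ℝ≥0} {Lres : ℝ≥0}
    (hLres : ∀ x i, LipschitzWith Lres fun v : H i => gradient f (setBlock x i v))
    (hL : ∀ x i, LipschitzWith (L i) fun v : H i => (gradient f (setBlock x i v)) i)
    {xm : PiLp 2 H} (hxm : xm ∈ argminSet (objective f g))
    {Ω : Type*} [MeasurableSpace Ω] {P : Measure Ω} [IsProbabilityMeasure P]
    {s : ℕ → Ω → Fin m} (hs : ∀ k, Measurable (s k)) (hind : iIndepFun s P)
    {p : Fin m → ℝ} (hp_pos : ∀ i, 0 < p i) (hp : ∀ k i, P.real {ω | s k ω = i} = p i)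
    {τ : ℕ} {d : ℕ → Fin m → ℕ} (hd : ∀ k i, d k i ≤ min k τ)
    {γ : Fin m → ℝ} (hγ : ∀ i, 0 < γ i) {x0 : PiLp 2 H} (hx0 : ∀ i, g i (x0 i) ≠ ⊤)
    {x : ℕ → Ω → PiLp 2 H}
    (hx : ∀ ω, IsGenerated f g γ d x0 (fun k => s k ω) fun k => x k ω)
    {δ : ℝ} (hδ : δ = deltaC L Lres γ p τ) (hδ_lt : δ < 2)
    {X : Set (PiLp 2 H)} {C : ℝ} (hC : 0 < C) (heb : LuoTsengErrorBound f g γ X C)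
    (hX : ∀ᵐ ω ∂P, ∀ k, x k ω ∈ X)
    {ρ : ℝ} (hρ : ρ = 1 - minOf p / (kappaC C δ + thetaC Lres γ p τ δ)) (k : ℕ) :
    ∫ ω, objR f g (x k ω) ∂P - objR f g xm ≤
        ρ ^ (k / (τ + 1)) * (objR f g x0 - objR f g xm) ∧
      (1 - δ / 2) * ∫ ω, normW (fun i => (γ i)⁻¹) (x (k + 1) ω - x k ω) ^ 2 ∂P ≤
        ρ ^ (k / (τ + 1)) * (objR f g x0 - objR f g xm) := by
  set κ := kappaC C δ with hκ
  set θ := thetaC Lres γ p τ δ with hθ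
  set u := maxOf p / √(minOf p) with hu
  set η := 1 - δ / 2 with hη
  set Fs := objR f g xm with hFs
  have hp1 : ∑ i, p i = 1 := sum_eq_one hs hp
  have hη0 : 0 < η := by linarith
  have hγM := maxOf_pos hγ
  have hpM := maxOf_pos hp_pos
  have hpm := minOf_pos hp_pos
  have hu0 : 0 < u := div_pos hpM (Real.sqrt_pos.2 hpm)
  have hK0 : (0 : ℝ) ≤ Lres := Lres.coe_nonneg
  have hpu : ∀ i, p i ≤ u ^ 2 := le_sq_maxOf_div_sqrt hp_pos
  have hstepsize : ∀ i, L i * γ i + 2 * γ i * τ * Lres * u ≤ 2 - 2 * η := fun i => by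
    have := stepsize_le_deltaC L Lres γ p τ i
    linarith
  set q := maxOf γ * τ * Lres * u with hq
  have hq0 : 0 ≤ q := by positivity
  have hqη : q ≤ 1 - η := by
    have := two_mul_maxOf_le_deltaC L Lres hγ p τ
    linarith
  have hκmax : κ = max 1 (2 * C / (2 - δ)) := kappaC_eq_max hδ_lt
  have hκ1 : 1 ≤ κ := hκmax ▸ le_max_left _ _
  have hκC : C ≤ κ * η := by
    have h1 : 2 * C / (2 - δ) ≤ κ := hκmax ▸ le_max_right _ _
    rw [div_le_iff₀ (by linarith)] at h1
    rw [hη]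
    linarith
  have hθ0 : 0 ≤ θ := thetaC_nonneg hδ_lt hγ
  have hηθ : η * θ = τ * Lres * maxOf γ / 2 * (maxOf p * u + 1) := by
    have h1 : 2 - δ = 2 * η := by linarith
    rw [hθ, thetaC, h1, hu]
    field_simp
  have hpm1 : minOf p ≤ 1 := (minOf_le p 0).trans (le_one_of_sum_eq_one hp_pos hp1 0)
  have hgtop : ∀ ω k i, g i (x k ω i) ≠ ⊤ := fun ω k i => (hx ω).ne_top hg hγ hx0 k i
  set G : ℕ → ℝ := fun k => ∫ ω, objR f g (x k ω) ∂P - Fs with hG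
  set M : ℕ → ℝ := fun k => ∫ ω, ‖x (k + 1) ω - x k ω‖ ^ 2 ∂P with hM
  set N : ℕ → ℝ := fun k => ∫ ω, normW (fun i => (γ i)⁻¹) (x (k + 1) ω - x k ω) ^ 2 ∂P with hN
  have hGint : ∀ k, Integrable (fun ω => objR f g (x k ω)) P := fun k =>
    integrable_of_history hs hx k (fun y => objR f g (y k)) fun y y' h => by simp only [h k le_rfl]
  have hG0 : ∀ k, 0 ≤ G k := fun k => by
    have h1 : ∫ _, Fs ∂P ≤ ∫ ω, objR f g (x k ω) ∂P :=
      integral_mono (integrable_const _) (hGint k) fun ω =>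
        objR_le_of_mem_argminSet hg hxm (hgtop ω k)
    rw [integral_const, probReal_univ, one_smul] at h1
    exact sub_nonneg.2 h1
  have hM0 : ∀ k, 0 ≤ M k := fun k => integral_nonneg fun ω => sq_nonneg _
  have hN0 : ∀ k, 0 ≤ N k := fun k => integral_nonneg fun ω => sq_nonneg _
  have hMN : ∀ k, M k ≤ maxOf γ * N k := fun k => by
    rw [hM, hN, ← integral_const_mul]
    refine integral_mono
      (integrable_of_history hs hx (k + 1) (fun y => ‖y (k + 1) - y k‖ ^ 2) fun y y' h => by
        simp only [h _ le_rfl, h k (Nat.le_succ k)])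
      ((integrable_of_history hs hx (k + 1)
        (fun y => normW (fun i => (γ i)⁻¹) (y (k + 1) - y k) ^ 2) fun y y' h => by
          simp only [h _ le_rfl, h k (Nat.le_succ k)]).const_mul _) fun ω => norm_sq_le_mul_normW_sq hγ _
  have hfb : ∀ ω k i, IsForwardBackward (γ i) (g i) (x k ω i)
      (gradient f (delayed (fun k => x k ω) k (d k)) i) (fullUpdate f g γ d (fun k => x k ω) k i) :=
    fun ω k i => isForwardBackward_fullUpdate hg hγ (fun k => x k ω) k i
  have hdec : ∀ k, G (k + 1) ≤ G k - η * N k - Lres * u / 2 * (τ * M k - windowSum τ M k) := by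
    intro k
    have h1 := integral_step_le hs hind hp hγ hx τ k (b := 0) (b₀ := -1) (b₁ := 1) (b₂ := η)
      (b₃ := Lres * u / 2 * τ) (b₄ := -(Lres * u / 2)) (Eventually.of_forall fun ω => by
        have h2 := sum_objR_setBlock_le_of_delay hf hγ hL hLres (fun i => (hp_pos i).le) hp1 hu0.le
          hpu hstepsize (hgtop ω k) (hfb ω k) ((hx ω).sum_norm_sub_delayed_le hd k)
          (two_mul_windowSum_mul_le τ _ k)
        linarith)
    simp only [hG, hN, hM]
    linarith
  set E : ℝ := κ * η / 2 * (maxOf γ * u ^ 2 * Lres ^ 2 * τ) + minOf p * (Lres * τ / 2) with hE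
  have hgap : ∀ k, minOf p * G k ≤ κ * (G k - G (k + 1) +
      Lres * u / 2 * (windowSum τ M k - τ * M k)) + E * windowSum τ M k := by
    intro k
    have h1 := integral_step_le hs hind hp hγ hx τ k (b := -(minOf p * Fs))
      (b₀ := minOf p - κ) (b₁ := κ) (b₂ := 0) (b₃ := κ * (Lres * u / 2 * τ))
      (b₄ := -(κ * (Lres * u / 2)) - E) (hX.mono fun ω hω => by
        have h2 := mul_gap_le_of_delay hconv hf hg hγ hL hLres hC heb hxm hp1 hpm.le (minOf_le p)
          hu0.le hpu hstepsize hη0.le (by linarith) hγM.le (le_maxOf γ) hκ1 hκC (hω k) (hgtop ω k)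
          (hfb ω k) ((hx ω).sum_norm_sub_delayed_le hd k) (two_mul_windowSum_mul_le τ _ k)
          (windowSum_sq_le τ _ k)
        rw [← hE] at h2
        linarith)
    simp only [hG, hM]
    linarith
  have hinit : ∀ ω, x 0 ω = x0 := fun ω => (hx ω).init
  have hG0eq : G 0 = objR f g x0 - Fs := by
    simp only [hG, hinit, integral_const, probReal_univ, one_smul]
  -- The factor `κ` absorbs the second-order error, which is where a single block is exceptional.
  have habsorb : κ * (q ^ 2 / 2) + minOf p ≤ κ → (E + minOf p * (Lres * u / 2) * τ) * maxOf γ ≤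
      η * (κ + θ - minOf p) := by
    intro hκq
    exact absorption hη0 (zero_le_one.trans hκ1) hγM.le hu0.le hK0 (minOf_le_maxOf p) hpm1
      hηθ hκq
  have hconst : (E + minOf p * (Lres * u / 2) * τ) * maxOf γ ≤ η * (κ + θ - minOf p) ∨
      lyapunov τ (Lres * u / 2) G M 1 ≤ 0 := by
    rcases minOf_le_half_or_subsingleton hp_pos hp1 with hhalf | hsub
    · refine Or.inl (habsorb ?_)
      have h1 := mul_le_mul_of_nonneg_left (pow_le_one₀ hq0 (by linarith) : q ^ 2 ≤ 1)
        (zero_le_one.trans hκ1)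
      linarith
    · have hinj : ∀ i : Fin m, i = 0 := fun i => Subsingleton.elim i 0
      have hp0 : p 0 = 1 := by rw [← hp1, Fintype.sum_subsingleton p 0]
      have hpm_one : minOf p = 1 := by
        obtain ⟨i, hi⟩ := exists_eq_minOf p
        rw [hi, hinj i, hp0]
      have hM0N0 : M 0 = maxOf γ * N 0 := by
        simp only [hM, hN, ← integral_const_mul, norm_sq_eq_mul_normW_sq_of_subsingleton hγ]
      -- The first step has no delay, and it bounds `C` from below unless it ends at a minimizer.
      obtain ⟨β, h1, h2⟩ := expected_first_step hconv hf hg hLres hL hxm hs hind hp_pos hp hγ hx0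
        hx hstepsize hC heb hX
      have h3 : G 1 ≤ (C - η - q) * N 0 := by
        have h4 : (τ * Lres * u) * M 0 = q * N 0 := by
          rw [hM0N0, hq]
          ring
        rw [hpm_one] at h1
        simp only [hM, hN, hG, zero_add] at h1 h2 h4 ⊢
        linarith
      rcases (hN0 0).eq_or_lt with hzero | hpos
      · right
        have h4 : lyapunov τ (Lres * u / 2) G M 1 = G 1 + Lres * u / 2 * (τ * M 0) := by
          simp [lyapunov]
        rw [h4, hM0N0, ← hzero]
        rw [← hzero] at h3
        linarith
      · left
        refine habsorb ?_
        have h4 : η + q ≤ κ * η := by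
          have h5 : 0 ≤ (C - η - q) * N 0 := (hG0 1).trans h3
          have h6 := nonneg_of_mul_nonneg_left h5 hpos
          linarith
        rw [hpm_one]
        exact mul_half_sq_add_one_le hη0 hq0 hqη h4
  have hE0 : 0 ≤ E := by positivity
  have hlyap := lyapunov_le_pow_mul (c := Lres * u / 2) (by positivity) hη0 hpm.le hE0 hG0 hM0 hN0
    hMN hθ0 (by linarith) (by linarith) hγM.le hdec hgap hconst hρ k
  rw [hG0eq] at hlyap
  have hle : ∀ k, G k ≤ lyapunov τ (Lres * u / 2) G M k := le_lyapunov (by positivity) hM0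
  refine ⟨(hle k).trans hlyap, ?_⟩
  have h1 := lyapunov_succ_le hdec k
  have h2 := (hG0 (k + 1)).trans (hle (k + 1))
  simp only [hN] at h1
  linarith

end Rate

/-! ### Almost sure convergence from summable expectations -/

section AlmostSure

theorem summable_pow_div {r : ℝ} (hr0 : 0 ≤ r) (hr1 : r < 1) (τ : ℕ) :
    Summable fun k : ℕ => r ^ (k / (τ + 1)) := by
  have h1 : Summable fun z : ℕ × Fin (τ + 1) => r ^ z.1 * (1 : ℝ) :=
    (summable_geometric_of_lt_one hr0 hr1).mul_of_nonneg (Summable.of_finite (f := fun _ => (1 : ℝ)))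
      (fun n => pow_nonneg hr0 n) fun _ => zero_le_one
  have h2 := (Nat.divModEquiv (τ + 1)).summable_iff.2 h1
  refine h2.congr fun k => ?_
  simp [Nat.divModEquiv]

theorem tsum_ofReal_mul_pow_div_le {A r : ℝ} (hA : 0 ≤ A) (hr0 : 0 ≤ r) (hr1 : r < 1) (τ k : ℕ) :
    ∑' j : ℕ, ENNReal.ofReal (A * r ^ ((k + j) / (τ + 1))) ≤
      ENNReal.ofReal (A * (∑' j : ℕ, r ^ (j / (τ + 1))) * r ^ (k / (τ + 1))) := by
  have hs := summable_pow_div hr0 hr1 τ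
  have h1 : ∀ j : ℕ, ENNReal.ofReal (A * r ^ ((k + j) / (τ + 1))) ≤
      ENNReal.ofReal (A * r ^ (k / (τ + 1)) * r ^ (j / (τ + 1))) := fun j => by
    refine ENNReal.ofReal_le_ofReal ?_
    rw [mul_assoc, ← pow_add]
    exact mul_le_mul_of_nonneg_left
      (pow_le_pow_of_le_one hr0 hr1.le Nat.div_add_div_le_add_div) hA
  refine (ENNReal.tsum_le_tsum h1).trans (le_of_eq ?_)
  rw [← ENNReal.ofReal_tsum_of_nonneg (fun j => by positivity) (hs.mul_left _), tsum_mul_left]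
  congr 1
  ring

variable {Ω : Type*} [MeasurableSpace Ω] {P : Measure Ω}

theorem ae_tendsto_zero_of_integral_le {φ : ℕ → Ω → ℝ} (hφ : ∀ k, Integrable (φ k) P)
    (hφ0 : ∀ k ω, 0 ≤ φ k ω) {A r : ℝ} {τ : ℕ} (hA : 0 ≤ A) (hr0 : 0 ≤ r) (hr1 : r < 1)
    (h : ∀ k, ∫ ω, φ k ω ∂P ≤ A * r ^ (k / (τ + 1))) :
    ∀ᵐ ω ∂P, Tendsto (fun k => φ k ω) atTop (𝓝 0) := by
  have hmeas : ∀ k, AEMeasurable (fun ω => ENNReal.ofReal (φ k ω)) P := fun k =>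
    (hφ k).aemeasurable.ennreal_ofReal
  have hsum : ∫⁻ ω, ∑' k, ENNReal.ofReal (φ k ω) ∂P ≠ ∞ := by
    rw [lintegral_tsum hmeas]
    refine ne_top_of_le_ne_top ENNReal.ofReal_ne_top
      (le_trans (ENNReal.tsum_le_tsum fun k => ?_) (tsum_ofReal_mul_pow_div_le hA hr0 hr1 τ 0))
    rw [← ofReal_integral_eq_lintegral_ofReal (hφ k) (Eventually.of_forall (hφ0 k)), zero_add]
    exact ENNReal.ofReal_le_ofReal (h k)
  filter_upwards [ae_lt_top' (AEMeasurable.tsum hmeas) hsum] with ω hω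
  have h1 := (ENNReal.tendsto_toReal ENNReal.zero_ne_top).comp
    (ENNReal.tendsto_atTop_zero_of_tsum_ne_top hω.ne)
  refine h1.congr fun k => ?_
  simp [hφ0 k ω]

/-- Random sequences whose expected increments decay geometrically converge almost surely, and the
expected distance to the limit decays at the same rate. -/
theorem exists_limit_of_integral_norm_sub_le {E : Type*} [NormedAddCommGroup E] [CompleteSpace E]
    {x : ℕ → Ω → E} (hx : ∀ k, StronglyMeasurable (x k))
    (hint : ∀ k, Integrable (fun ω => x (k + 1) ω - x k ω) P) {A r : ℝ} {τ : ℕ} (hA : 0 ≤ A)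
    (hr0 : 0 ≤ r) (hr1 : r < 1)
    (h : ∀ k, ∫ ω, ‖x (k + 1) ω - x k ω‖ ∂P ≤ A * r ^ (k / (τ + 1))) :
    ∃ z : Ω → E, StronglyMeasurable z ∧ (∀ᵐ ω ∂P, Tendsto (fun k => x k ω) atTop (𝓝 (z ω))) ∧
      ∀ k, ∫⁻ ω, ‖x k ω - z ω‖ₑ ∂P ≤
        ENNReal.ofReal (A * (∑' j : ℕ, r ^ (j / (τ + 1))) * r ^ (k / (τ + 1))) := by
  have hmeas : ∀ k, AEMeasurable (fun ω => ‖x (k + 1) ω - x k ω‖ₑ) P := fun k =>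
    (hint k).aestronglyMeasurable.enorm
  have hle : ∀ k, ∫⁻ ω, ‖x (k + 1) ω - x k ω‖ₑ ∂P ≤ ENNReal.ofReal (A * r ^ (k / (τ + 1))) :=
    fun k => by
      rw [← ofReal_integral_norm_eq_lintegral_enorm (hint k)]
      exact ENNReal.ofReal_le_ofReal (h k)
  have htail : ∀ k, ∫⁻ ω, ∑' j, ‖x (k + j + 1) ω - x (k + j) ω‖ₑ ∂P ≤
      ENNReal.ofReal (A * (∑' j : ℕ, r ^ (j / (τ + 1))) * r ^ (k / (τ + 1))) := fun k => by
    rw [lintegral_tsum fun j => hmeas (k + j)]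
    exact (ENNReal.tsum_le_tsum fun j => hle (k + j)).trans
      (tsum_ofReal_mul_pow_div_le hA hr0 hr1 τ k)
  have hedist : ∀ ω k, edist (x k ω) (x k.succ ω) ≤ ‖x (k + 1) ω - x k ω‖ₑ := fun ω k => by
    rw [edist_comm, edist_eq_enorm_sub]
  have hfin := htail 0
  simp only [zero_add] at hfin
  have hcauchy : ∀ᵐ ω ∂P, ∃ l, Tendsto (fun k => x k ω) atTop (𝓝 l) := by
    filter_upwards [ae_lt_top' (AEMeasurable.tsum hmeas)
      (ne_top_of_le_ne_top ENNReal.ofReal_ne_top hfin)] with ω hω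
    exact cauchySeq_tendsto_of_complete
      (cauchySeq_of_edist_le_of_tsum_ne_top _ (hedist ω) hω.ne)
  obtain ⟨z, hz, hlim⟩ := exists_stronglyMeasurable_limit_of_tendsto_ae
    (fun k => (hx k).aestronglyMeasurable) hcauchy
  refine ⟨z, hz, hlim, fun k => le_trans (lintegral_mono_ae ?_) (htail k)⟩
  filter_upwards [hlim] with ω hω
  rw [← edist_eq_enorm_sub]
  exact edist_le_tsum_of_edist_le_of_tendsto _ (hedist ω) hω k

theorem sq_integral_le_integral_sq [IsProbabilityMeasure P] {φ : Ω → ℝ} (h1 : Integrable φ P)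
    (h2 : Integrable (fun ω => φ ω ^ 2) P) : (∫ ω, φ ω ∂P) ^ 2 ≤ ∫ ω, φ ω ^ 2 ∂P := by
  set c := ∫ ω, φ ω ∂P with hc
  have h := affine_integral_nonpos (P := P) (b := -c ^ 2) (b₀ := -1) (b₁ := 2 * c) (b₂ := 0)
    (b₃ := 0) (b₄ := 0) h2 h1 h1 h1 h1 (Eventually.of_forall fun ω => by
      nlinarith [sq_nonneg (φ ω - c)])
  rw [← hc] at h
  linarith

end AlmostSure

/-! ### The objective is lower semicontinuous -/

section Objective

variable {m : ℕ} {H : Fin m → Type*} [∀ i, NormedAddCommGroup (H i)]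

theorem continuous_normW (a : Fin m → ℝ) : Continuous (normW (H := H) a) := by
  unfold normW
  fun_prop

theorem normW_le_mul_norm {a : Fin m → ℝ} (ha : ∀ i, 0 ≤ a i) (v : PiLp 2 H) :
    normW a v ≤ √(∑ i, a i) * ‖v‖ := by
  refine le_of_sq_le_sq ?_ (by positivity)
  rw [normW_sq ha, mul_pow, Real.sq_sqrt (Finset.sum_nonneg fun i _ => ha i), Finset.sum_mul]
  exact Finset.sum_le_sum fun i _ => mul_le_mul_of_nonneg_left
    (pow_le_pow_left₀ (norm_nonneg _) (PiLp.norm_apply_le v i) 2) (ha i)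

variable [∀ i, InnerProductSpace ℝ (H i)] {f : PiLp 2 H → ℝ} {g : ∀ i, H i → EReal}

theorem lowerSemicontinuous_objective (hf : Continuous f) (hg : ∀ i, ProperConvexLSC (g i)) :
    LowerSemicontinuous (objective f g) := by
  have hadd : ∀ {φ ψ : PiLp 2 H → EReal}, LowerSemicontinuous φ → LowerSemicontinuous ψ →
      (∀ x, φ x ≠ ⊥) → (∀ x, ψ x ≠ ⊥) → LowerSemicontinuous fun x => φ x + ψ x :=
    fun hφ hψ hφb hψb => hφ.add' hψ fun x =>
      EReal.continuousAt_add (Or.inr (hψb x)) (Or.inl (hφb x))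
  have hsum : ∀ t : Finset (Fin m), LowerSemicontinuous fun x : PiLp 2 H => ∑ i ∈ t, g i (x i) := by
    intro t
    induction t using Finset.induction_on with
    | empty =>
      simp only [Finset.sum_empty]
      exact lowerSemicontinuous_const
    | insert i t hi ih =>
      simp only [Finset.sum_insert hi]
      exact hadd ((hg i).lsc.comp (by fun_prop)) ih (fun x => (hg i).ne_bot _)
        fun x => sum_ne_bot hg x t
  exact hadd (continuous_coe_real_ereal.comp hf).lowerSemicontinuous (hsum Finset.univ)
    (fun x => EReal.coe_ne_bot _) fun x => sum_ne_bot hg x _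

/-- A limit of a minimizing sequence is a minimizer. -/
theorem mem_argminSet_of_tendsto (hf : Continuous f) (hg : ∀ i, ProperConvexLSC (g i))
    {xm : PiLp 2 H} (hxm : xm ∈ argminSet (objective f g)) {y : ℕ → PiLp 2 H}
    (hy : ∀ k i, g i (y k i) ≠ ⊤)
    (hgap : Tendsto (fun k => objR f g (y k) - objR f g xm) atTop (𝓝 0)) {z : PiLp 2 H}
    (hz : Tendsto y atTop (𝓝 z)) : z ∈ argminSet (objective f g) := by
  have hle : objective f g z ≤ objective f g xm := by
    by_contra hlt
    push Not at hlt
    rw [objective_eq_coe hg (ne_top_of_mem_argminSet hg hxm)] at hlt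
    obtain ⟨c, hc1, hc2⟩ := EReal.lt_iff_exists_real_btwn.1 hlt
    rw [EReal.coe_lt_coe_iff] at hc1
    have hev : ∀ᶠ k in atTop, c - objR f g xm ≤ objR f g (y k) - objR f g xm := by
      filter_upwards [hz.eventually (lowerSemicontinuous_objective hf hg z _ hc2)] with k hk
      rw [objective_eq_coe hg (hy k), gt_iff_lt, EReal.coe_lt_coe_iff] at hk
      linarith
    have := ge_of_tendsto hgap hev
    linarith
  exact fun w => hle.trans (hxm w)

end Objective

/-! ### The expected gap as an extended nonnegative integral -/

section Gap

variable {m : ℕ} {H : Fin m → Type*} [∀ i, NormedAddCommGroup (H i)]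
  [∀ i, InnerProductSpace ℝ (H i)] {f : PiLp 2 H → ℝ} {g : ∀ i, H i → EReal}

/-- When the gap is finite and integrable, `expGap` is the Bochner integral of the
real-valued gap, so that inequalities between real expectations transfer to it. -/
theorem expGap_eq_ofReal (hg : ∀ i, ProperConvexLSC (g i)) {xm : PiLp 2 H}
    (hxm : xm ∈ argminSet (objective f g)) {Ω : Type*} [MeasurableSpace Ω] {P : Measure Ω}
    [IsProbabilityMeasure P] {Y : Ω → PiLp 2 H} (hY : ∀ ω i, g i (Y ω i) ≠ ⊤)
    (hint : Integrable (fun ω => objR f g (Y ω)) P) :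
    expGap P (objective f g) Y = ENNReal.ofReal (∫ ω, objR f g (Y ω) ∂P - objR f g xm) := by
  have hinf : ⨅ z, objective f g z = (objR f g xm : EReal) := by
    rw [← objective_eq_coe hg (ne_top_of_mem_argminSet hg hxm)]
    exact le_antisymm (iInf_le _ xm) (le_iInf hxm)
  have hval : ∀ ω, (objective f g (Y ω) - ⨅ z, objective f g z).toENNReal =
      ENNReal.ofReal (objR f g (Y ω) - objR f g xm) := fun ω => by
    rw [hinf, objective_eq_coe hg (hY ω), ← EReal.coe_sub,
      EReal.toENNReal_of_ne_top (EReal.coe_ne_top _), EReal.toReal_coe]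
  rw [expGap]
  simp only [hval]
  have hsub : Integrable (fun ω => objR f g (Y ω) - objR f g xm) P :=
    hint.sub (integrable_const _)
  rw [← ofReal_integral_eq_lintegral_ofReal hsub
    (Eventually.of_forall fun ω => sub_nonneg.2 (objR_le_of_mem_argminSet hg hxm (hY ω))),
    integral_sub hint (integrable_const _), integral_const, probReal_univ, one_smul]

end Gap

end AsyncFB

theorem theorem4p1
    {m : ℕ} [NeZero m]
    {H : Fin m → Type*} [∀ i, NormedAddCommGroup (H i)] [∀ i, InnerProductSpace ℝ (H i)]
    [∀ i, CompleteSpace (H i)] [∀ i, TopologicalSpace.SeparableSpace (H i)]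
    -- the problem
    (f : PiLp 2 H → ℝ) (g : ∀ i, H i → EReal)
    (hf_convex : ConvexOn ℝ Set.univ f) (hf_diff : Differentiable ℝ f)
    (hg : ∀ i, AsyncFB.ProperConvexLSC (g i))
    (L : Fin m → ℝ≥0) (Lres : ℝ≥0) (hLres_pos : 0 < Lres)
    (hLres : ∀ (x : PiLp 2 H) (i : Fin m),
      LipschitzWith Lres fun v : H i => gradient f (AsyncFB.setBlock x i v))
    (hL : ∀ (x : PiLp 2 H) (i : Fin m),
      LipschitzWith (L i) fun v : H i => (gradient f (AsyncFB.setBlock x i v)) i)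
    (hmin : (AsyncFB.argminSet (AsyncFB.objective f g)).Nonempty)
    -- the random block selection, the delays, the stepsizes and the iterates
    {Ω : Type*} [MeasurableSpace Ω] (P : Measure Ω) [IsProbabilityMeasure P]
    (s : ℕ → Ω → Fin m) (hs_meas : ∀ k, Measurable (s k)) (hs_indep : iIndepFun s P)
    (p : Fin m → ℝ) (hp_pos : ∀ i, 0 < p i) (hp : ∀ k i, P.real {ω | s k ω = i} = p i)
    (τ : ℕ) (d : ℕ → Fin m → ℕ) (hd : ∀ k i, d k i ≤ min k τ)
    (γ : Fin m → ℝ) (hγ : ∀ i, 0 < γ i)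
    (x0 : PiLp 2 H) (hx0 : AsyncFB.objective f g x0 ≠ ⊤)
    (x : ℕ → Ω → PiLp 2 H)
    (hx : ∀ ω, AsyncFB.IsGenerated f g γ d x0 (fun k => s k ω) (fun k => x k ω))
    -- the stepsize condition and the error bound
    (δ : ℝ) (hδ : δ = AsyncFB.deltaC L Lres γ p τ) (hδ_lt : δ < 2)
    (X : Set (PiLp 2 H)) (C : ℝ) (hC : 0 < C)
    (heb : AsyncFB.LuoTsengErrorBound f g γ X C)
    (hX : ∀ᵐ ω ∂P, ∀ k, x k ω ∈ X)
    (κ θ ρ : ℝ) (hκ : κ = AsyncFB.kappaC C δ) (hθ : θ = AsyncFB.thetaC Lres γ p τ δ)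
    (hρ : ρ = 1 - AsyncFB.minOf p / (κ + θ)) :
    (∀ k : ℕ, AsyncFB.expGap P (AsyncFB.objective f g) (x (k + 1)) ≤
      ENNReal.ofReal (ρ ^ ((k + 1) / (τ + 1))) *
        AsyncFB.expGap P (AsyncFB.objective f g) (x 0)) ∧
    κ = max 1 (2 * C / (2 - δ)) ∧
    θ ≤ √(AsyncFB.minOf p) / (AsyncFB.maxOf p * (2 - δ)) *
      (AsyncFB.maxOf p ^ 2 / √(AsyncFB.minOf p) + 1) ∧
    ∃ xstar : Ω → PiLp 2 H, StronglyMeasurable xstar ∧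
      (∀ ω, xstar ω ∈ AsyncFB.argminSet (AsyncFB.objective f g)) ∧
      (∀ᵐ ω ∂P, Tendsto (fun k => x k ω) atTop (𝓝 (xstar ω))) ∧
      (∀ k, Integrable (fun ω => AsyncFB.normW (fun i => (γ i)⁻¹) (x k ω - xstar ω)) P) ∧
      (fun k : ℕ => ∫ ω, AsyncFB.normW (fun i => (γ i)⁻¹) (x k ω - xstar ω) ∂P) =O[atTop]
        fun k : ℕ => ρ ^ (((k / (τ + 1) : ℕ) : ℝ) / 2) := by

  obtain ⟨xm, hxm⟩ := hmin
  have hx0' := (AsyncFB.objective_ne_top_iff hg).1 hx0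
  have hpm := AsyncFB.minOf_pos hp_pos
  have hκmax : κ = max 1 (2 * C / (2 - δ)) := by rw [hκ, AsyncFB.kappaC_eq_max hδ_lt]
  have hκ1 : 1 ≤ κ := hκmax ▸ le_max_left _ _
  have hθ0 : 0 ≤ θ := hθ ▸ AsyncFB.thetaC_nonneg hδ_lt hγ
  have hrate := AsyncFB.expected_rate hf_convex hf_diff hg hLres hL hxm hs_meas hs_indep hp_pos hp
    hd hγ hx0' hx hδ hδ_lt hC heb hX (ρ := ρ) (by rw [hρ, hκ, hθ])
  have hρ0 : 0 ≤ ρ := by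
    have h1 := (AsyncFB.minOf_le p 0).trans
      (AsyncFB.le_one_of_sum_eq_one hp_pos (AsyncFB.sum_eq_one hs_meas hp) 0)
    rw [hρ, sub_nonneg, div_le_one (by linarith)]
    linarith
  have hρ1 : ρ < 1 := by
    rw [hρ]
    have : 0 < AsyncFB.minOf p / (κ + θ) := div_pos hpm (by linarith)
    linarith
  have hη : 0 < 1 - δ / 2 := by linarith
  set D := AsyncFB.objR f g x0 - AsyncFB.objR f g xm with hD
  have hD0 : 0 ≤ D := sub_nonneg.2 (AsyncFB.objR_le_of_mem_argminSet hg hxm hx0')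
  have htop : ∀ ω k i, g i (x k ω i) ≠ ⊤ := fun ω k i => (hx ω).ne_top hg hγ hx0' k i
  have hint : ∀ k, Integrable (fun ω => AsyncFB.objR f g (x k ω)) P := fun k =>
    AsyncFB.integrable_of_history hs_meas hx k (fun y => AsyncFB.objR f g (y k))
      fun y y' h => by simp only [h k le_rfl]
  refine ⟨fun k => ?_, hκmax, hθ ▸ AsyncFB.thetaC_le hδ hδ_lt hγ hp_pos, ?_⟩
  · rw [AsyncFB.expGap_eq_ofReal hg hxm (fun ω => htop ω (k + 1)) (hint (k + 1)),
      AsyncFB.expGap_eq_ofReal hg hxm (fun ω => htop ω 0) (hint 0),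
      ← ENNReal.ofReal_mul (pow_nonneg hρ0 _)]
    refine ENNReal.ofReal_le_ofReal ?_
    have hinit : ∀ ω, x 0 ω = x0 := fun ω => (hx ω).init
    simp only [hinit, integral_const, probReal_univ, one_smul]
    exact (hrate (k + 1)).1
  set a : Fin m → ℝ := fun i => (γ i)⁻¹ with ha
  have ha0 : ∀ i, 0 ≤ a i := fun i => (inv_pos.2 (hγ i)).le
  set r := √ρ with hr
  have hr0 : 0 ≤ r := Real.sqrt_nonneg _
  have hr1 : r < 1 := by rw [hr, Real.sqrt_lt' one_pos, one_pow]; exact hρ1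
  have hdep : ∀ k, AsyncFB.DependsOnPast s k (x k) := fun k =>
    AsyncFB.dependsOnPast_iterate hx le_rfl
  have hmeas : ∀ k, StronglyMeasurable (x k) := fun k => (hdep k).stronglyMeasurable hs_meas
  have hxint : ∀ k, Integrable (x k) P := fun k => (hdep k).integrable hs_meas
  have hstep : ∀ k, Integrable (fun ω => x (k + 1) ω - x k ω) P := fun k =>
    (hxint (k + 1)).sub (hxint k)
  have hsq : ∀ k, Integrable (fun ω => ‖x (k + 1) ω - x k ω‖ ^ 2) P := fun k =>
    AsyncFB.integrable_of_history hs_meas hx (k + 1) (fun y => ‖y (k + 1) - y k‖ ^ 2)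
      fun y y' h => by simp only [h _ le_rfl, h k (Nat.le_succ k)]
  have hsqW : ∀ k, Integrable (fun ω => AsyncFB.normW a (x (k + 1) ω - x k ω) ^ 2) P := fun k =>
    AsyncFB.integrable_of_history hs_meas hx (k + 1)
      (fun y => AsyncFB.normW a (y (k + 1) - y k) ^ 2)
      fun y y' h => by simp only [h _ le_rfl, h k (Nat.le_succ k)]
  set A := √(AsyncFB.maxOf γ * (D / (1 - δ / 2))) with hA
  have hincr : ∀ k, ∫ ω, ‖x (k + 1) ω - x k ω‖ ∂P ≤ A * r ^ (k / (τ + 1)) := by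
    intro k
    have h1 := AsyncFB.sq_integral_le_integral_sq (hstep k).norm (hsq k)
    have h2 : ∫ ω, ‖x (k + 1) ω - x k ω‖ ^ 2 ∂P ≤
        AsyncFB.maxOf γ * ∫ ω, AsyncFB.normW a (x (k + 1) ω - x k ω) ^ 2 ∂P := by
      rw [← integral_const_mul]
      exact integral_mono (hsq k) ((hsqW k).const_mul _) fun ω =>
        AsyncFB.norm_sq_le_mul_normW_sq hγ _
    have h3 := (hrate k).2
    rw [mul_comm, ← le_div_iff₀ hη] at h3
    have hγM := AsyncFB.maxOf_pos hγ
    refine le_of_sq_le_sq (h1.trans (h2.trans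
      ((mul_le_mul_of_nonneg_left h3 hγM.le).trans (le_of_eq ?_)))) (by positivity)
    rw [mul_pow, hA, Real.sq_sqrt (by positivity), ← pow_mul, mul_comm (k / (τ + 1)) 2, pow_mul, hr,
      Real.sq_sqrt hρ0]
    ring
  obtain ⟨z, hz, hlim, hdist⟩ := AsyncFB.exists_limit_of_integral_norm_sub_le hmeas hstep
    (Real.sqrt_nonneg _) hr0 hr1 hincr
  have hgap : ∀ᵐ ω ∂P, Tendsto (fun k => AsyncFB.objR f g (x k ω) - AsyncFB.objR f g xm) atTop
      (𝓝 0) := by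
    refine AsyncFB.ae_tendsto_zero_of_integral_le (τ := τ) (A := D) (r := ρ)
      (fun k => (hint k).sub (integrable_const _))
      (fun k ω => sub_nonneg.2 (AsyncFB.objR_le_of_mem_argminSet hg hxm (htop ω k))) hD0 hρ0 hρ1
      fun k => ?_
    rw [integral_sub (hint k) (integrable_const _), integral_const, probReal_univ, one_smul,
      mul_comm]
    exact (hrate k).1
  have hzmem : ∀ᵐ ω ∂P, z ω ∈ AsyncFB.argminSet (AsyncFB.objective f g) := by
    filter_upwards [hlim, hgap] with ω h1 h2
    exact AsyncFB.mem_argminSet_of_tendsto hf_diff.continuous hg hxm (htop ω) h2 h1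
  -- Redefine the limit as `xm` on a measurable null set outside which it is a minimizer.
  obtain ⟨xstar, hxs, hxs_mem, hxs_eq⟩ : ∃ xstar : Ω → PiLp 2 H, StronglyMeasurable xstar ∧
      (∀ ω, xstar ω ∈ AsyncFB.argminSet (AsyncFB.objective f g)) ∧ xstar =ᵐ[P] z := by
    classical
    set B := toMeasurable P {ω | z ω ∉ AsyncFB.argminSet (AsyncFB.objective f g)} with hB
    have hBm : MeasurableSet B := measurableSet_toMeasurable _ _
    have hB0 : P B = 0 := by rw [hB, measure_toMeasurable]; exact hzmem
    refine ⟨B.piecewise (fun _ => xm) z, StronglyMeasurable.piecewise hBm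
      stronglyMeasurable_const hz, fun ω => ?_, ?_⟩
    · by_cases hω : ω ∈ B
      · rwa [Set.piecewise_eq_of_mem _ _ _ hω]
      · rw [Set.piecewise_eq_of_notMem _ _ _ hω]
        by_contra hmem
        exact hω (subset_toMeasurable _ _ hmem)
    · filter_upwards [measure_eq_zero_iff_ae_notMem.1 hB0] with ω hω
      exact Set.piecewise_eq_of_notMem _ _ _ hω
  set S := A * ∑' j : ℕ, r ^ (j / (τ + 1)) with hS
  have hS0 : 0 ≤ S := mul_nonneg (Real.sqrt_nonneg _) (tsum_nonneg fun j => pow_nonneg hr0 _)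
  have hdist' : ∀ k, ∫⁻ ω, ‖x k ω - xstar ω‖ₑ ∂P ≤ ENNReal.ofReal (S * r ^ (k / (τ + 1))) :=
    fun k => by
      refine le_trans (le_of_eq (lintegral_congr_ae ?_)) (hdist k)
      filter_upwards [hxs_eq] with ω hω
      rw [hω]
  have hxsint : ∀ k, Integrable (fun ω => x k ω - xstar ω) P := fun k =>
    ⟨((hmeas k).sub hxs).aestronglyMeasurable, (hdist' k).trans_lt ENNReal.ofReal_lt_top⟩
  have hW : ∀ k, Integrable (fun ω => AsyncFB.normW a (x k ω - xstar ω)) P := fun k =>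
    ((hxsint k).norm.const_mul √(∑ i, a i)).mono'
      ((AsyncFB.continuous_normW a).comp_stronglyMeasurable
        ((hmeas k).sub hxs)).aestronglyMeasurable
      (Eventually.of_forall fun ω => by
        rw [Real.norm_of_nonneg (AsyncFB.normW_nonneg a _)]
        exact AsyncFB.normW_le_mul_norm ha0 _)
  refine ⟨xstar, hxs, hxs_mem, ?_, hW, ?_⟩
  · filter_upwards [hlim, hxs_eq] with ω h1 h2
    rwa [h2]
  · refine IsBigO.of_bound (√(∑ i, a i) * S) (Eventually.of_forall fun k => ?_)
    rw [Real.norm_of_nonneg (integral_nonneg fun ω => AsyncFB.normW_nonneg a _),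
      Real.rpow_div_two_eq_sqrt _ hρ0, Real.rpow_natCast, ← hr,
      Real.norm_of_nonneg (pow_nonneg hr0 _), mul_assoc]
    have h1 : ∫ ω, AsyncFB.normW a (x k ω - xstar ω) ∂P ≤
        √(∑ i, a i) * ∫ ω, ‖x k ω - xstar ω‖ ∂P := by
      rw [← integral_const_mul]
      exact integral_mono (hW k) ((hxsint k).norm.const_mul _) fun ω =>
        AsyncFB.normW_le_mul_norm ha0 _
    refine h1.trans (mul_le_mul_of_nonneg_left ?_ (Real.sqrt_nonneg _))
    have h2 := hdist' k
    rw [← ofReal_integral_norm_eq_lintegral_enorm (hxsint k)] at h2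
    exact (ENNReal.ofReal_le_ofReal_iff (mul_nonneg hS0 (pow_nonneg hr0 _))).1 h2
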